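/- All trees are finite, nonempty, rooted, unordered and node-labeled, with labels from an arbitrary set. A node insertion operation on a tree creates a new node $v$ with an arbitrary label and either attaches $v$ as a child of some node $u$ of the tree, where $v$ becomes the parent of a (possibly empty) subset of the children of $u$ instead of $u$, or makes the root of the tree a child of $v$, so that $v$ is the new root. A tree $P$ is included in a tree $T$ if some finite sequence of node insertion operations turns $P$ into $T$. The unordered tree inclusion problem asks, given $P$ and $T$, whether $P$ is included in $T$. Let $m$ and $n$ be the numbers of nodes of $P$ and of $T$, and let $d$ be the maximum outdegree (number of children) of a node of $P$. Theorem. There are a single algorithm and constants $C,k\in\mathbb{N}$ such that, for all trees $P$ and $T$ for which the leaves of $P$ carry pairwise distinct labels and each label of a leaf of $P$ occurs at no more than $3$ nodes of $T$, the algorithm correctly decides whether $P$ is included in $T$ within at most $C\cdot 1.8^{d}\cdot(m+n)^{k}$ steps. That is, the problem restricted to these inputs can be solved in $O(1.8^{d}\cdot \mathrm{poly}(m,n))$ time. Here an algorithm is a fixed deterministic program of first-order recursive functions on nested pairs over $\mathrm{nil}$ and labels, independent of the label set. The input is the pair of the two trees, each written as the pair of its root label and the list of its child subtrees in any order. The operations,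 each counted as one step, are: access to a variable, $\mathrm{nil}$, forming a pair, case distinction on a value ($\mathrm{nil}$, label, or pair, with access to the two components of a pair), test of two labels for equality, local definition, and function call. Each of them takes constant time on a random access machine that stores a label in one cell. -/

import Mathlib

namespace TreeInclusion

/-! ## Rooted node-labeled trees -/

/-- Rooted trees with node labels in `Λ`: a root label and the list of the subtrees at the children.
The order of a child list is only a representation: all notions below ignore it. -/
inductive LTree (Λ : Type) : Type
  | node (a : Λ) (cs : List (LTree Λ)) : LTree Λ

namespace LTree

variable {Λ : Type}

/-- The labels of all nodes, one entry for each node. -/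
def labels : LTree Λ → List Λ
  | node a cs => a :: (cs.map labels).flatten

/-- The labels of all leaves (nodes without children), one entry for each leaf. -/
def leafLabels : LTree Λ → List Λ
  | node a cs => if cs.isEmpty then [a] else (cs.map leafLabels).flatten

/-- The number of nodes. -/
def size (t : LTree Λ) : ℕ := t.labels.length

/-- The maximum outdegree (number of children) of a node. -/
def maxOutdegree : LTree Λ → ℕ
  | node _ cs => max cs.length ((cs.map maxOutdegree).foldr max 0)

/-- The two trees differ only in the order of the child list of one node, so that they represent
the same unordered tree. -/
inductive Reorder : LTree Λ → LTree Λ → Prop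
  | here (a : Λ) {cs ds : List (LTree Λ)} : cs.Perm ds → Reorder (node a cs) (node a ds)
  | deeper (a : Λ) (l r : List (LTree Λ)) {t t' : LTree Λ} : Reorder t t' →
      Reorder (node a (l ++ t :: r)) (node a (l ++ t' :: r))

/-- A node with an arbitrary label `a` is attached as a child of a node `u` of the tree, and
becomes the parent of a (possibly empty) subset `moved` of the children of `u` instead of `u`. -/
inductive InsertBelow : LTree Λ → LTree Λ → Prop
  | here (a b : Λ) {cs moved rest : List (LTree Λ)} : cs.Perm (moved ++ rest) →
      InsertBelow (node b cs) (node b (node a moved :: rest))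
  | deeper (b : Λ) (l r : List (LTree Λ)) {t t' : LTree Λ} : InsertBelow t t' →
      InsertBelow (node b (l ++ t :: r)) (node b (l ++ t' :: r))

/-- One node insertion operation: below a node of the tree, or above its root. -/
inductive NodeInsertion : LTree Λ → LTree Λ → Prop
  | child {s t : LTree Λ} : InsertBelow s t → NodeInsertion s t
  | root (a : Λ) (t : LTree Λ) : NodeInsertion t (node a [t])

/-- `P` is included in `T` as an unordered tree: a finite sequence of node insertion operations
turns `P` into `T`, where the order of children does not matter. -/
def Included (P T : LTree Λ) : Prop :=
  Relation.ReflTransGen (fun s t => Reorder s t ∨ NodeInsertion s t) P T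

end LTree

/-! ## The machine model: first-order recursive list programs with unit-cost steps

Data are built by pairing from `nil` and from atoms (labels). A program is a finite list of
function bodies, each with one argument, which may call each other recursively. The only
operations are variable access, `nil`, pairing, case analysis of a value (with access to the two
components of a pair), the equality test of two atoms, local definitions and function calls.
Values are immutable and can be shared, so each operation takes constant time on a random access
machine or a pointer machine that stores labels in single cells. -/

/-- Values: `nil`, labels, and pairs. -/
inductive Val (Λ : Type) : Type
  | nil : Val Λ
  | atom (a : Λ) : Val Λ
  | pair (x y : Val Λ) : Val Λ

/-- Expressions. `var i` is the `i`-th most recently bound variable. `case e e₀ e₁ e₂` continues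
with `e₀`, `e₁` or `e₂` if the value of `e` is `nil`, an atom or a pair; in `e₂` the first and the
second component of the pair are bound to `var 0` and `var 1`. `ifEq e₁ e₂ e₃ e₄` continues with
`e₃` if the values of `e₁` and `e₂` are equal atoms and with `e₄` otherwise. `bind e₁ e₂`
evaluates `e₂` with `var 0` bound to the value of `e₁`. `call f e` applies the `f`-th function of
the program to the value of `e`. -/
inductive Exp : Type
  | var (i : ℕ) : Exp
  | nil : Exp
  | pair (e₁ e₂ : Exp) : Exp
  | case (e e₀ e₁ e₂ : Exp) : Exp
  | ifEq (e₁ e₂ e₃ e₄ : Exp) : Exp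
  | bind (e₁ e₂ : Exp) : Exp
  | call (f : ℕ) (e : Exp) : Exp

/-- A program: the bodies of its functions. In a body, `var 0` is the argument. -/
abbrev Program : Type := List Exp

/-- `Eval prog env e v t`: in the environment `env`, the expression `e` evaluates to `v` in
exactly `t` steps. Each evaluation of an expression costs one step in addition to the steps of
the evaluations that it causes. -/
inductive Eval {Λ : Type} (prog : Program) : List (Val Λ) → Exp → Val Λ → ℕ → Prop
  | var {env : List (Val Λ)} {i : ℕ} {v : Val Λ} :
      env[i]? = some v → Eval prog env (.var i) v 1
  | nil {env : List (Val Λ)} : Eval prog env .nil .nil 1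
  | pair {env : List (Val Λ)} {e₁ e₂ : Exp} {v₁ v₂ : Val Λ} {t₁ t₂ : ℕ} :
      Eval prog env e₁ v₁ t₁ → Eval prog env e₂ v₂ t₂ →
      Eval prog env (.pair e₁ e₂) (.pair v₁ v₂) (t₁ + t₂ + 1)
  | case_nil {env : List (Val Λ)} {e e₀ e₁ e₂ : Exp} {v : Val Λ} {s t : ℕ} :
      Eval prog env e .nil s → Eval prog env e₀ v t →
      Eval prog env (.case e e₀ e₁ e₂) v (s + t + 1)
  | case_atom {env : List (Val Λ)} {e e₀ e₁ e₂ : Exp} {a : Λ} {v : Val Λ} {s t : ℕ} :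
      Eval prog env e (.atom a) s → Eval prog env e₁ v t →
      Eval prog env (.case e e₀ e₁ e₂) v (s + t + 1)
  | case_pair {env : List (Val Λ)} {e e₀ e₁ e₂ : Exp} {x y v : Val Λ} {s t : ℕ} :
      Eval prog env e (.pair x y) s → Eval prog (x :: y :: env) e₂ v t →
      Eval prog env (.case e e₀ e₁ e₂) v (s + t + 1)
  | ifEq_true {env : List (Val Λ)} {e₁ e₂ e₃ e₄ : Exp} {a : Λ} {v : Val Λ} {t₁ t₂ t : ℕ} :
      Eval prog env e₁ (.atom a) t₁ → Eval prog env e₂ (.atom a) t₂ → Eval prog env e₃ v t →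
      Eval prog env (.ifEq e₁ e₂ e₃ e₄) v (t₁ + t₂ + t + 1)
  | ifEq_false {env : List (Val Λ)} {e₁ e₂ e₃ e₄ : Exp} {v₁ v₂ v : Val Λ} {t₁ t₂ t : ℕ} :
      Eval prog env e₁ v₁ t₁ → Eval prog env e₂ v₂ t₂ →
      (¬ ∃ a : Λ, v₁ = .atom a ∧ v₂ = .atom a) → Eval prog env e₄ v t →
      Eval prog env (.ifEq e₁ e₂ e₃ e₄) v (t₁ + t₂ + t + 1)
  | bind {env : List (Val Λ)} {e₁ e₂ : Exp} {v w : Val Λ} {s t : ℕ} :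
      Eval prog env e₁ v s → Eval prog (v :: env) e₂ w t →
      Eval prog env (.bind e₁ e₂) w (s + t + 1)
  | call {env : List (Val Λ)} {f : ℕ} {body e : Exp} {v w : Val Λ} {s t : ℕ} :
      prog[f]? = some body → Eval prog env e v s → Eval prog [v] body w t →
      Eval prog env (.call f e) w (s + t + 1)

/-- The model is deterministic: result and number of steps are unique. -/
theorem Eval.deterministic {Λ : Type} {prog : Program} {env : List (Val Λ)} {e : Exp}
    {v : Val Λ} {t : ℕ} (h : Eval prog env e v t) :
    ∀ {v' : Val Λ} {t' : ℕ}, Eval prog env e v' t' → v = v' ∧ t = t' := by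
  induction h with
  | var h => intro v' t' h'; cases h' with | var h' => simp_all
  | nil => intro v' t' h'; cases h'; simp
  | pair _ _ ih₁ ih₂ =>
    intro v' t' h'
    cases h' with
    | pair a b =>
      obtain ⟨rfl, rfl⟩ := ih₁ a
      obtain ⟨rfl, rfl⟩ := ih₂ b
      simp
  | case_nil _ _ ih₁ ih₂ =>
    intro v' t' h'
    cases h' with
    | case_nil a b => have := ih₁ a; have := ih₂ b; simp_all
    | case_atom a b => have := ih₁ a; simp_all
    | case_pair a b => have := ih₁ a; simp_all
  | case_atom _ _ ih₁ ih₂ =>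
    intro v' t' h'
    cases h' with
    | case_nil a b => have := ih₁ a; simp_all
    | case_atom a b => have := ih₁ a; have := ih₂ b; simp_all
    | case_pair a b => have := ih₁ a; simp_all
  | case_pair _ _ ih₁ ih₂ =>
    intro v' t' h'
    cases h' with
    | case_nil a b => have := ih₁ a; simp_all
    | case_atom a b => have := ih₁ a; simp_all
    | case_pair a b =>
      obtain ⟨h, rfl⟩ := ih₁ a
      injection h with h₁ h₂
      subst h₁ h₂
      obtain ⟨rfl, rfl⟩ := ih₂ b
      simp
  | ifEq_true _ _ _ ih₁ ih₂ ih₃ =>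
    intro v' t' h'
    cases h' with
    | ifEq_true a b c => have := ih₁ a; have := ih₂ b; have := ih₃ c; simp_all
    | ifEq_false a b n c =>
      obtain ⟨rfl, rfl⟩ := ih₁ a
      obtain ⟨rfl, rfl⟩ := ih₂ b
      simp at n
  | ifEq_false _ _ n _ ih₁ ih₂ ih₃ =>
    intro v' t' h'
    cases h' with
    | ifEq_true a b c =>
      obtain ⟨rfl, rfl⟩ := ih₁ a
      obtain ⟨rfl, rfl⟩ := ih₂ b
      simp at n
    | ifEq_false a b n c =>
      obtain ⟨rfl, rfl⟩ := ih₁ a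
      obtain ⟨rfl, rfl⟩ := ih₂ b
      obtain ⟨rfl, rfl⟩ := ih₃ c
      simp
  | bind _ _ ih₁ ih₂ =>
    intro v' t' h'
    cases h' with
    | bind a b =>
      obtain ⟨rfl, rfl⟩ := ih₁ a
      obtain ⟨rfl, rfl⟩ := ih₂ b
      simp
  | call hf _ _ ih₁ ih₂ =>
    intro v' t' h'
    cases h' with
    | call hf' a b =>
      obtain ⟨rfl, rfl⟩ := ih₁ a
      rw [hf] at hf'
      injection hf' with hf'
      subst hf'
      obtain ⟨rfl, rfl⟩ := ih₂ b
      simp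

/-- On the input `x`, the program (its function number `0`) halts with the output `y` after
exactly `t` steps. -/
def Program.Runs {Λ : Type} (prog : Program) (x y : Val Λ) (t : ℕ) : Prop :=
  Eval prog [x] (.call 0 (.var 0)) y t

/-! ## Input and output -/

/-- A list as nested pairs that end in `nil`. -/
def Val.ofList {Λ : Type} : List (Val Λ) → Val Λ
  | [] => .nil
  | x :: xs => .pair x (Val.ofList xs)

/-- A tree as the pair of its root label and the list of its encoded child subtrees. -/
def LTree.encode {Λ : Type} : LTree Λ → Val Λ
  | .node a cs => .pair (.atom a) (Val.ofList (cs.map LTree.encode))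

/-- The two answers of a decision program. -/
def Val.ofBool {Λ : Type} : Bool → Val Λ
  | true => .pair .nil .nil
  | false => .nil

end TreeInclusion

namespace TreeInclusion

variable {Λ : Type}

/-! Inclusion is a question about embeddings. `P` is included in `T` exactly if the nodes of `P` can
be mapped to nodes of `T` with equal labels so that children go to proper descendants and siblings
go to pairwise incomparable nodes (`included_iff`). One direction pulls the identity embedding of
`T` back through the insertions. The other builds `T` around the image by recursion on the forest
(`grows_of_emb`).

For a subtree of `P` only the lowest nodes that can host its root matter: moving the image of a
child further down keeps it below the image of its parent and incomparable to the images of its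
siblings. The lowest hosts form an antichain, and each has at or below it an occurrence of any fixed
leaf label of the subtree. Incomparable nodes cannot share an occurrence, so there are at most three
lowest hosts (`cands_spec`).

To test one node of `T` for a node of `P` with `r` children, one element must therefore be chosen
from each of `r` domains of size at most three, pairwise incomparable. The domains are treated two
at a time. The two chosen elements occupy at most two of the indices `0, 1, 2`, so both avoid some
common index, and a threefold branching over that index cuts both domains to size two
(`branch_iff`). This gives about `3 ^ (r / 2)` instances, and `√3 < 1.8`.

An instance with domains of size at most two is a 2-SAT problem. If unit propagation after a
tentative choice meets no contradiction, the domains that remain are untouched members of the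
original family, so the choice never has to be revised (`solve_iff`). This takes polynomial time.
The lemmas named `fn_...` verify that the program computes these functions and bound its steps. -/

theorem LTree.induction {motive : LTree Λ → Prop}
    (node : ∀ a cs, (∀ c ∈ cs, motive c) → motive (.node a cs)) : ∀ t, motive t
  | .node a cs => node a cs fun c _ => LTree.induction node c

/-! ## Positions -/

/-- A position in a forest: `true` skips a tree and `false` enters it. -/
abbrev Pos : Type := List Bool

/-- The second position is a proper descendant of the first one. -/
def below : Pos → Pos → Bool
  | [], [] => false
  | [], _ :: _ => true
  | _ :: _, [] => false
  | a :: p, b :: q => (a == b) && below p q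

/-- The two positions are incomparable. -/
def apart : Pos → Pos → Bool
  | [], _ => false
  | _ :: _, [] => false
  | a :: p, b :: q => (a != b) || apart p q

/-- The position of a node ends in `false`, and exactly its descendants have positions that extend
it, because later siblings branch off by `true`. Ancestry is thus the prefix order. -/
theorem below_iff : ∀ {p q : Pos}, below p q = true ↔ p <+: q ∧ p ≠ q
  | [], [] => by simp [below]
  | [], _ :: _ => by simp [below]
  | _ :: _, [] => by simp [below]
  | a :: p, b :: q => by
    simp only [below, Bool.and_eq_true, beq_iff_eq, below_iff (p := p), List.cons_prefix_cons]
    constructor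
    · rintro ⟨rfl, h, h'⟩; simpa using ⟨h, h'⟩
    · rintro ⟨⟨rfl, h⟩, h'⟩; exact ⟨rfl, h, by simpa using h'⟩

theorem apart_iff : ∀ {p q : Pos}, apart p q = true ↔ ¬ p <+: q ∧ ¬ q <+: p
  | [], q => by simp [apart]
  | _ :: _, [] => by simp [apart]
  | a :: p, b :: q => by
    by_cases h : a = b
    · subst h; simp [apart, apart_iff (p := p)]
    · simp [apart, h, Ne.symm h]

theorem apart_symm {p q : Pos} (h : apart p q = true) : apart q p = true := by
  rw [apart_iff] at *; exact h.symm

/-- Two prefixes of one list are comparable, so extensions of incomparable positions stay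
incomparable. This is what permits moving images downwards. -/
theorem apart_mono {p q p' q' : Pos} (h : apart p q = true) (hp : p <+: p') (hq : q <+: q') :
    apart p' q' = true := by
  rw [apart_iff] at *
  constructor
  · intro h'
    rcases List.prefix_or_prefix_of_prefix (hp.trans h') hq with h1 | h1
    · exact h.1 h1
    · exact h.2 h1
  · intro h'
    rcases List.prefix_or_prefix_of_prefix hp (hq.trans h') with h1 | h1
    · exact h.1 h1
    · exact h.2 h1

theorem below_of_below_of_prefix {p q r : Pos} (h : below p q = true) (h' : q <+: r) :
    below p r = true := by
  rw [below_iff] at *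
  refine ⟨h.1.trans h', ?_⟩
  rintro rfl
  exact h.2 (h.1.eq_of_length_le h'.length_le)

theorem below_trans {p q r : Pos} (h : below p q = true) (h' : below q r = true) :
    below p r = true :=
  below_of_below_of_prefix h (below_iff.1 h').1

/-- The nodes of a forest, as pairs of position and label. -/
def nodes : List (LTree Λ) → List (Pos × Λ)
  | [] => []
  | .node a cs :: ts => ([false], a) ::
      ((nodes cs).map (fun x => (false :: x.1, x.2)) ++
        (nodes ts).map (fun x => (true :: x.1, x.2)))

/-- The tree can be embedded into the labeled set `L` of positions with its root at the given
position. -/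
def Emb (L : List (Pos × Λ)) : LTree Λ → Pos → Prop
  | .node a cs, p => (p, a) ∈ L ∧ ∃ vs,
      List.Forall₂ (fun (S : Pos → Prop) v => S v ∧ below p v = true) (cs.map (Emb L)) vs ∧
      vs.Pairwise (fun v w => apart v w = true)

/-- The `map` in `Emb` serves the recursion; this is the working form of the definition. -/
theorem emb_node {L : List (Pos × Λ)} {a : Λ} {cs : List (LTree Λ)} {p : Pos} :
    Emb L (.node a cs) p ↔ (p, a) ∈ L ∧ ∃ vs,
      List.Forall₂ (fun c v => Emb L c v ∧ below p v = true) cs vs ∧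
      vs.Pairwise (fun v w => apart v w = true) := by
  rw [Emb]; simp only [List.forall₂_map_left_iff]

theorem pairwise_apart_perm {vs ws : List Pos} (h : vs.Perm ws)
    (hp : ws.Pairwise (fun v w => apart v w = true)) :
    vs.Pairwise (fun v w => apart v w = true) :=
  (h.pairwise_iff (fun h => apart_symm h)).2 hp

theorem forall₂_replace {α β : Type*} {R : α → β → Prop} {t t' : α} {r : List α}
    (h : ∀ v, R t' v → R t v) : ∀ {l : List α} {vs : List β},
    List.Forall₂ R (l ++ t' :: r) vs → List.Forall₂ R (l ++ t :: r) vs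
  | [], _, .cons h1 h2 => .cons (h _ h1) h2
  | _ :: _, _, .cons h1 h2 => .cons h1 (forall₂_replace h h2)

theorem emb_deeper {L : List (Pos × Λ)} {a : Λ} {l r : List (LTree Λ)} {t t' : LTree Λ}
    (h : ∀ v, Emb L t' v → Emb L t v) {p : Pos} (hp : Emb L (.node a (l ++ t' :: r)) p) :
    Emb L (.node a (l ++ t :: r)) p := by
  rw [emb_node] at *
  obtain ⟨hl, vs, h1, h2⟩ := hp
  exact ⟨hl, vs, forall₂_replace (fun v hv => ⟨h v hv.1, hv.2⟩) h1, h2⟩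

theorem emb_perm {L : List (Pos × Λ)} {a : Λ} {cs ds : List (LTree Λ)} (h : cs.Perm ds)
    {p : Pos} (hp : Emb L (.node a ds) p) : Emb L (.node a cs) p := by
  rw [emb_node] at *
  obtain ⟨hl, vs, h1, h2⟩ := hp
  obtain ⟨ws, h3, h4⟩ := List.perm_comp_forall₂ h h1
  exact ⟨hl, ws, h3, pairwise_apart_perm h4 h2⟩

/-! ### Pulling embeddings back along insertions -/

theorem emb_of_reorder {L : List (Pos × Λ)} {s t : LTree Λ} (h : LTree.Reorder s t) :
    ∀ p, Emb L t p → Emb L s p := by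
  induction h with
  | here a h => exact fun p => emb_perm h
  | deeper a l r _ ih => exact fun p => emb_deeper ih

/-- The image `v` of the inserted node can simply be forgotten: the images of the moved children lie
below `v`, hence below the image of the old parent, and they are incomparable to everything that `v`
is incomparable to. -/
theorem emb_of_insertBelow {L : List (Pos × Λ)} {s t : LTree Λ} (h : LTree.InsertBelow s t) :
    ∀ p, Emb L t p → Emb L s p := by
  induction h with
  | here a b h =>
    intro p hp
    refine emb_perm h ?_
    rw [emb_node] at *
    obtain ⟨hl, vs, h1, h2⟩ := hp
    cases h1 with
    | @cons _ v _ vs h1 h3 =>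
      rw [emb_node] at h1
      obtain ⟨⟨_, ws, h4, h5⟩, h6⟩ := h1
      rw [List.pairwise_cons] at h2
      refine ⟨hl, ws ++ vs, List.rel_append (h4.imp fun _ _ h => ⟨h.1, below_trans h6 h.2⟩) h3, ?_⟩
      rw [List.pairwise_append]
      refine ⟨h5, h2.2, fun w hw v' hv' => apart_mono (h2.1 v' hv') ?_ List.prefix_rfl⟩
      have : ∀ {cs ws}, List.Forall₂ (fun c w => Emb L c w ∧ below v w = true) cs ws →
          ∀ w ∈ ws, below v w = true := by
        intro cs ws h
        induction h with
        | nil => simp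
        | cons h _ ih => simpa using ⟨h.2, ih⟩
      exact (below_iff.1 (this h4 w hw)).1
  | deeper b l r _ ih => exact fun p => emb_deeper ih

theorem emb_of_included {L : List (Pos × Λ)} {P T : LTree Λ} (h : P.Included T) :
    (∃ p, Emb L T p) → ∃ p, Emb L P p := by
  induction h using Relation.ReflTransGen.head_induction_on with
  | refl => exact id
  | head h _ ih =>
    intro hT
    obtain ⟨p, hp⟩ := ih hT
    rcases h with h | h
    · exact ⟨p, emb_of_reorder h p hp⟩
    · cases h with
      | child h => exact ⟨p, emb_of_insertBelow h p hp⟩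
      | root a t =>
        rw [emb_node] at hp
        obtain ⟨_, vs, h1, _⟩ := hp
        cases h1 with
        | cons h1 _ => exact ⟨_, h1.1⟩

/-- The identity embedding. The path `w` is general so that the recursion can continue both into the
children, at `w ++ [false]`, and to the later siblings, at `w ++ [true]`. -/
theorem emb_forest_self {L : List (Pos × Λ)} : ∀ (ts : List (LTree Λ)) (w : Pos),
    (∀ x ∈ nodes ts, (w ++ x.1, x.2) ∈ L) → ∃ vs,
      List.Forall₂ (fun c v => Emb L c v ∧ below w v = true) ts vs ∧
      vs.Pairwise (fun v w => apart v w = true)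
  | [], w, _ => ⟨[], .nil, .nil⟩
  | .node a cs :: ts, w, h => by
    simp only [nodes, List.mem_cons, List.mem_append, List.mem_map] at h
    obtain ⟨vs, h1, h2⟩ := emb_forest_self cs (w ++ [false]) (fun x hx => by
      simpa using h _ (.inr (.inl ⟨x, hx, rfl⟩)))
    obtain ⟨ws, h3, h4⟩ := emb_forest_self ts (w ++ [true]) (fun x hx => by
      simpa using h _ (.inr (.inr ⟨x, hx, rfl⟩)))
    have hb : ∀ {cs ws}, List.Forall₂ (fun c v => Emb L c v ∧ below (w ++ [true]) v = true) cs ws →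
          ∀ v ∈ ws, w ++ [true] <+: v := by
      intro cs ws h
      induction h with
      | nil => simp
      | cons h _ ih => simpa using ⟨(below_iff.1 h.2).1, ih⟩
    refine ⟨(w ++ [false]) :: ws, .cons ⟨emb_node.2 ⟨h ([false], a) (.inl rfl), vs, h1, h2⟩, ?_⟩
      (h3.imp fun _ _ h => ⟨h.1, below_trans (below_iff.2 (by simp)) h.2⟩),
      List.pairwise_cons.2 ⟨fun v hv => ?_, h4⟩⟩
    · simp [below_iff]
    · refine apart_mono (p := w ++ [false]) (q := w ++ [true]) ?_ List.prefix_rfl (hb h3 v hv)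
      simp [apart_iff]

theorem exists_emb_of_included {P T : LTree Λ} (h : P.Included T) :
    ∃ p, Emb (nodes [T]) P p := by
  refine emb_of_included h ?_
  obtain ⟨vs, h1, _⟩ := emb_forest_self (L := nodes [T]) [T] [] (by simp)
  cases h1 with
  | cons h1 _ => exact ⟨_, h1.1⟩

/-! ## Insertions from embeddings -/

/-- Insertions below the root and reorderings. -/
abbrev Grows : LTree Λ → LTree Λ → Prop :=
  Relation.ReflTransGen fun s t => LTree.Reorder s t ∨ LTree.InsertBelow s t

theorem Grows.included {s t : LTree Λ} (h : Grows s t) : s.Included t :=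
  Relation.ReflTransGen.mono (fun _ _ h => h.imp id LTree.NodeInsertion.child) _ _ h

theorem Grows.perm (a : Λ) {cs ds : List (LTree Λ)} (h : cs.Perm ds) :
    Grows (.node a cs) (.node a ds) :=
  .single (.inl (.here a h))

theorem Grows.deeper (a : Λ) (l r : List (LTree Λ)) {t t' : LTree Λ} (h : Grows t t') :
    Grows (.node a (l ++ t :: r)) (.node a (l ++ t' :: r)) := by
  induction h with
  | refl => exact .refl
  | tail _ h ih => exact ih.tail (h.imp (.deeper a l r) (.deeper a l r))

/-- An embedding rooted at `x :: w` uses only extensions of this position, so the leading bit can be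
stripped. The hypothesis is limited to extensions of `w` because the root of the first tree, at
`[false]`, has no counterpart among the nodes of its child forest. -/
theorem emb_restrict {L L' : List (Pos × Λ)} {x : Bool} (u : LTree Λ) : ∀ {w : Pos},
    (∀ q c, w <+: q → (x :: q, c) ∈ L → (q, c) ∈ L') → Emb L u (x :: w) → Emb L' u w := by
  induction u using LTree.induction with
  | node a cs ih =>
    intro w hL h
    rw [emb_node] at *
    obtain ⟨h1, vs, h2, h3⟩ := h
    have key : ∀ {cs : List (LTree Λ)} {vs},
        (∀ c ∈ cs, ∀ {w : Pos}, (∀ q c, w <+: q → (x :: q, c) ∈ L → (q, c) ∈ L') →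
          Emb L c (x :: w) → Emb L' c w) →
        List.Forall₂ (fun c v => Emb L c v ∧ below (x :: w) v = true) cs vs →
        ∃ ws, vs = ws.map (x :: ·) ∧
          List.Forall₂ (fun c v => Emb L' c v ∧ below w v = true) cs ws := by
      intro cs vs hc h
      induction h with
      | nil => exact ⟨[], rfl, .nil⟩
      | @cons c v cs vs h _ ih =>
        obtain ⟨ws, rfl, h'⟩ := ih (fun c hc' => hc c (by simp [hc']))
        obtain ⟨h4, h5⟩ := h
        cases v with
        | nil => simp [below] at h5
        | cons y v =>
          simp only [below, Bool.and_eq_true, beq_iff_eq] at h5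
          obtain ⟨rfl, h5⟩ := h5
          refine ⟨v :: ws, rfl, .cons ⟨hc c (by simp) (fun q c hq => ?_) h4, h5⟩ h'⟩
          exact hL q c ((below_iff.1 h5).1.trans hq)
    obtain ⟨ws, rfl, h4⟩ := key ih h2
    refine ⟨hL _ _ List.prefix_rfl h1, ws, h4, ?_⟩
    rw [List.pairwise_map] at h3
    exact h3.imp (by simp [apart])

theorem emb_mem {L : List (Pos × Λ)} {u : LTree Λ} {p : Pos} (h : Emb L u p) :
    ∃ a, (p, a) ∈ L := by
  cases u; rw [emb_node] at h; exact ⟨_, h.1⟩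

theorem nodes_ne_nil : ∀ {ts : List (LTree Λ)} {x : Pos × Λ}, x ∈ nodes ts → x.1 ≠ []
  | [], _, h => by simp [nodes] at h
  | .node a cs :: ts, x, h => by
    simp only [nodes, List.mem_cons, List.mem_append, List.mem_map] at h
    rcases h with rfl | ⟨y, _, rfl⟩ | ⟨y, _, rfl⟩ <;> simp

theorem forall₂_partition {L : List (Pos × Λ)} (hL : ∀ x ∈ L, x.1 ≠ [])
    {Ps : List (LTree Λ)} {vs : List Pos} (h : List.Forall₂ (Emb L) Ps vs) :
    ∃ Ps₁ Ps₂ vs₁ vs₂, Ps.Perm (Ps₁ ++ Ps₂) ∧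
      vs.Perm (vs₁.map (false :: ·) ++ vs₂.map (true :: ·)) ∧
      List.Forall₂ (fun c v => Emb L c (false :: v)) Ps₁ vs₁ ∧
      List.Forall₂ (fun c v => Emb L c (true :: v)) Ps₂ vs₂ := by
  induction h with
  | nil => exact ⟨[], [], [], [], .refl _, .refl _, .nil, .nil⟩
  | @cons P v Ps vs h _ ih =>
    obtain ⟨Ps₁, Ps₂, vs₁, vs₂, h1, h2, h3, h4⟩ := ih
    rcases v with _ | ⟨_ | _, v⟩
    · obtain ⟨a, ha⟩ := emb_mem h
      exact absurd rfl (hL _ ha)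
    · exact ⟨P :: Ps₁, Ps₂, v :: vs₁, vs₂, h1.cons _, h2.cons _, .cons h h3, h4⟩
    · exact ⟨Ps₁, P :: Ps₂, vs₁, v :: vs₂, (h1.cons _).trans List.perm_middle.symm,
        (h2.cons _).trans List.perm_middle.symm, h3, .cons h h4⟩

theorem mem_nodes_false {b : Λ} {ds ts : List (LTree Λ)} {q : Pos} {c : Λ} (hq : q ≠ []) :
    (false :: q, c) ∈ nodes (.node b ds :: ts) → (q, c) ∈ nodes ds := by
  simp only [nodes, List.mem_cons, List.mem_append, List.mem_map]
  rintro (h | ⟨y, hy, h⟩ | ⟨y, _, h⟩)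
  · simp_all
  · cases h; exact hy
  · simp at h

theorem mem_nodes_true {b : Λ} {ds ts : List (LTree Λ)} {q : Pos} {c : Λ} :
    (true :: q, c) ∈ nodes (.node b ds :: ts) → (q, c) ∈ nodes ts := by
  simp only [nodes, List.mem_cons, List.mem_append, List.mem_map]
  rintro (h | ⟨y, _, h⟩ | ⟨y, hy, h⟩)
  · simp at h
  · simp at h
  · cases h; exact hy

theorem emb_root {a b : Λ} {cs ds ts : List (LTree Λ)}
    (h : Emb (nodes (.node b ds :: ts)) (.node a cs) [false]) :
    a = b ∧ ∃ ws, List.Forall₂ (Emb (nodes ds)) cs ws ∧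
      ws.Pairwise (fun v w => apart v w = true) := by
  rw [emb_node] at h
  obtain ⟨h5, ws, h6, h7⟩ := h
  refine ⟨?_, ?_⟩
  · simp only [nodes, List.mem_cons, List.mem_append, List.mem_map] at h5
    rcases h5 with h | ⟨y, hy, h⟩ | ⟨y, _, h⟩
    · simpa using h
    · have := nodes_ne_nil hy
      simp_all
    · simp at h
  · have key : ∀ {cs : List (LTree Λ)} {vs},
        List.Forall₂ (fun c v => Emb (nodes (.node b ds :: ts)) c v ∧ below [false] v = true)
          cs vs →
        ∃ ws, vs = ws.map (false :: ·) ∧ List.Forall₂ (Emb (nodes ds)) cs ws := by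
      intro cs vs h
      induction h with
      | nil => exact ⟨[], rfl, .nil⟩
      | @cons c v cs vs h _ ih =>
        obtain ⟨ws, rfl, h'⟩ := ih
        obtain ⟨h, hb⟩ := h
        rcases v with _ | ⟨_ | _, _ | ⟨y, v⟩⟩ <;> simp [below] at hb
        refine ⟨(y :: v) :: ws, rfl, .cons (emb_restrict c (fun q c hq => ?_) h) h'⟩
        exact mem_nodes_false (by rintro rfl; simp at hq)
    obtain ⟨ws, rfl, h8⟩ := key h6
    rw [List.pairwise_map] at h7
    exact ⟨ws, h8, h7.imp (by simp [apart])⟩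

/-- Recursion on the target forest. The first bit tells whether a pattern tree lies in the first
target tree or in a later one. If one lies at the root of the first tree, it is alone there;
otherwise an insertion above the possibly empty group creates that root. The children `ds` and the
later trees `Ts` are then handled recursively, while `xs` carries along siblings that stay
unchanged. -/
theorem grows_of_emb : ∀ (Ts Ps : List (LTree Λ)) (vs : List Pos),
    List.Forall₂ (Emb (nodes Ts)) Ps vs → vs.Pairwise (fun v w => apart v w = true) →
    ∀ (c : Λ) (xs : List (LTree Λ)), Grows (.node c (xs ++ Ps)) (.node c (xs ++ Ts))
  | [], Ps, vs, h, _, c, xs => by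
    cases h with
    | nil => exact .refl
    | cons h _ => obtain ⟨a, ha⟩ := emb_mem h; simp [nodes] at ha
  | .node b ds :: Ts, Ps, vs, h, hv, c, xs => by
    obtain ⟨Ps₁, Ps₂, vs₁, vs₂, h1, h2, h3, h4⟩ := forall₂_partition (fun x => nodes_ne_nil) h
    have hv' := pairwise_apart_perm h2.symm hv
    rw [List.pairwise_append, List.pairwise_map, List.pairwise_map] at hv'
    simp only [apart, bne_self_eq_false, Bool.false_or] at hv'
    have hrest := grows_of_emb Ts Ps₂ vs₂
      (h4.imp fun P v h => emb_restrict P (fun q c _ => mem_nodes_true) h) hv'.2.1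
    have hroot : ∃ Qs, Grows (.node c (xs ++ (Ps₁ ++ Ps₂))) (.node c (xs ++ .node b Qs :: Ps₂)) ∧
        ∃ ws, List.Forall₂ (Emb (nodes ds)) Qs ws ∧
          ws.Pairwise (fun v w => apart v w = true) := by
      by_cases hr : [] ∈ vs₁
      -- With the leading bit stripped, the root is `[]`, which is comparable to every position, so
      -- the antichain has no other member.
      · have hs : vs₁ = [[]] := by
          obtain ⟨l, r, rfl⟩ := List.append_of_mem hr
          have := hv'.1
          rw [List.pairwise_append, List.pairwise_cons] at this
          have hl : l = [] := by
            cases l with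
            | nil => rfl
            | cons x l =>
              have := apart_iff.1 (this.2.2 x (by simp) [] (by simp)); simp at this
          have hr : r = [] := by
            cases r with
            | nil => rfl
            | cons x r => have := this.2.1.1 x (by simp); simp [apart] at this
          simp [hl, hr]
        subst hs
        cases h3 with
        | @cons P _ _ _ h5 h6 =>
          cases h6
          obtain ⟨a, Qs⟩ := P
          obtain ⟨rfl, ws, h8⟩ := emb_root h5
          exact ⟨Qs, .refl, ws, h8⟩
      · refine ⟨Ps₁, ?_, vs₁, ?_, hv'.1⟩
        · refine ((Grows.perm c ?_).tail (.inr (.here b c (.refl (Ps₁ ++ (xs ++ Ps₂)))))).trans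
            (Grows.perm c ?_)
          · rw [← List.append_assoc, ← List.append_assoc]
            exact List.perm_append_comm.append_right _
          · exact List.perm_middle.symm
        · have : ∀ {cs : List (LTree Λ)} {vs}, [] ∉ vs →
              List.Forall₂ (fun c v => Emb (nodes (.node b ds :: Ts)) c (false :: v)) cs vs →
              List.Forall₂ (Emb (nodes ds)) cs vs := by
            intro cs vs hn h
            induction h with
            | nil => exact .nil
            | @cons c v cs vs h _ ih =>
              simp only [List.mem_cons, not_or] at hn
              refine .cons (emb_restrict c (fun q c hq => mem_nodes_false ?_) h) (ih hn.2)
              rintro rfl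
              exact hn.1 (List.prefix_nil.1 hq).symm
          exact this hr h3
    obtain ⟨Qs, hq, ws, h5, h6⟩ := hroot
    have hin := grows_of_emb ds Qs ws h5 h6 b []
    have hrest' := hrest c (xs ++ [.node b ds])
    simp only [List.append_assoc, List.singleton_append] at hrest'
    exact (((Grows.perm c (h1.append_left xs)).trans hq).trans (hin.deeper c xs Ps₂)).trans hrest'

theorem included_of_emb {P T : LTree Λ} {p : Pos} (h : Emb (nodes [T]) P p) : P.Included T := by
  obtain ⟨b, ds⟩ := T
  obtain ⟨a, ha⟩ := emb_mem h
  have hp := nodes_ne_nil ha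
  rcases p with _ | ⟨_ | _, p⟩
  · simp at hp
  · by_cases hp' : p = []
    · subst hp'
      obtain ⟨c, cs⟩ := P
      obtain ⟨rfl, ws, h1, h2⟩ := emb_root h
      exact (grows_of_emb ds cs ws h1 h2 c []).included
    -- The root of `T` is not an image here, so it is supplied by an insertion above the root of
    -- `P`.
    · have h' : Emb (nodes ds) P p := emb_restrict P (fun q c hq => mem_nodes_false (by
        rintro rfl; exact hp' (List.prefix_nil.1 hq))) h
      exact Relation.ReflTransGen.head (.inr (.root b P))
        (grows_of_emb ds [P] [p] (.cons h' .nil) (by simp) b []).included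
  · have := mem_nodes_true ha
    simp [nodes] at this

theorem included_iff {P T : LTree Λ} : P.Included T ↔ ∃ p, Emb (nodes [T]) P p :=
  ⟨exists_emb_of_included, fun ⟨_, h⟩ => included_of_emb h⟩

/-! ## Choosing pairwise incomparable positions -/

/-- Pairwise incomparable positions can be chosen, one from each of the given domains. -/
def Sat (ds : List (List Pos)) : Prop :=
  ∃ vs, List.Forall₂ (fun d v => v ∈ d) ds vs ∧ vs.Pairwise (fun v w => apart v w = true)

theorem Sat.perm {ds es : List (List Pos)} (h : ds.Perm es) (hs : Sat ds) : Sat es := by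
  obtain ⟨vs, h1, h2⟩ := hs
  obtain ⟨ws, h3, h4⟩ := List.perm_comp_forall₂ h.symm h1
  exact ⟨ws, h3, pairwise_apart_perm h4 h2⟩

theorem sat_perm {ds es : List (List Pos)} (h : ds.Perm es) : Sat ds ↔ Sat es :=
  ⟨Sat.perm h, Sat.perm h.symm⟩

theorem Sat.mono {ds es : List (List Pos)} (h : List.Forall₂ (· ⊆ ·) ds es) (hs : Sat ds) :
    Sat es := by
  obtain ⟨vs, h1, h2⟩ := hs
  refine ⟨vs, ?_, h2⟩
  clear h2
  induction h generalizing vs with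
  | nil => exact h1
  | cons h _ ih => cases h1 with | cons h3 h4 => exact .cons (h h3) (ih _ h4)

theorem Sat.sublist {ds es : List (List Pos)} (h : ds.Sublist es) (hs : Sat es) : Sat ds := by
  obtain ⟨vs, h1, h2⟩ := hs
  have : ∃ ws, List.Forall₂ (fun d v => v ∈ d) ds ws ∧ ws.Sublist vs := by
    clear h2
    induction h generalizing vs with
    | slnil => exact ⟨[], .nil, List.nil_sublist _⟩
    | cons a _ ih =>
      cases h1 with
      | cons h3 h4 => obtain ⟨ws, h5, h6⟩ := ih _ h4; exact ⟨ws, h5, h6.cons _⟩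
    | cons_cons a _ ih =>
      cases h1 with
      | cons h3 h4 =>
        obtain ⟨ws, h5, h6⟩ := ih _ h4; exact ⟨_, .cons h3 h5, h6.cons_cons _⟩
  obtain ⟨ws, h3, h4⟩ := this
  exact ⟨ws, h3, h2.sublist h4⟩

/-- The domains restricted to the positions that are incomparable to `q`. -/
def filterApart (q : Pos) (ds : List (List Pos)) : List (List Pos) :=
  ds.map (List.filter (apart q))

@[simp] theorem length_filterApart (q : Pos) (ds : List (List Pos)) :
    (filterApart q ds).length = ds.length := List.length_map _

theorem sat_filterApart {q : Pos} {ds : List (List Pos)} :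
    Sat (filterApart q ds) ↔ ∃ vs, List.Forall₂ (fun d v => v ∈ d) ds vs ∧
      (∀ v ∈ vs, apart q v = true) ∧ vs.Pairwise (fun v w => apart v w = true) := by
  have : ∀ {vs : List Pos}, List.Forall₂ (fun d v => v ∈ d) (filterApart q ds) vs ↔
      List.Forall₂ (fun d v => v ∈ d) ds vs ∧ ∀ v ∈ vs, apart q v = true := by
    intro vs
    rw [filterApart, List.forall₂_map_left_iff]
    induction ds generalizing vs with
    | nil => cases vs <;> simp
    | cons d ds ih =>
      cases vs
      · simp
      · rw [List.forall₂_cons, ih, List.forall₂_cons, List.mem_filter, List.forall_mem_cons]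
        tauto
  simp only [Sat, this, and_assoc]

theorem sat_cons {d : List Pos} {ds : List (List Pos)} :
    Sat (d :: ds) ↔ ∃ q ∈ d, Sat (filterApart q ds) := by
  simp only [sat_filterApart]
  constructor
  · rintro ⟨_, _ | ⟨h1, h2⟩, h3⟩
    rw [List.pairwise_cons] at h3
    exact ⟨_, h1, _, h2, h3⟩
  · rintro ⟨q, hq, vs, h1, h2⟩
    exact ⟨q :: vs, .cons hq h1, List.pairwise_cons.2 h2⟩

theorem sat_nil : Sat [] := ⟨[], .nil, .nil⟩

theorem not_sat_nil_cons {ds : List (List Pos)} : ¬ Sat ([] :: ds) := by simp [sat_cons]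

/-- Splits off the first domain with at most one element. -/
def findShort : List (List Pos) → Option (List Pos × List (List Pos))
  | [] => none
  | d :: ds => if d.length ≤ 1 then some (d, ds) else
      match findShort ds with
      | none => none
      | some (e, es) => some (e, d :: es)

theorem findShort_none : ∀ {ds : List (List Pos)}, findShort ds = none → ∀ d ∈ ds, 2 ≤ d.length
  | [], _ => by simp
  | d :: ds, h => by
    rw [findShort] at h
    split_ifs at h with h1
    split at h
    next h2 => simpa using ⟨by omega, findShort_none h2⟩
    next => simp at h

theorem findShort_some : ∀ {ds : List (List Pos)} {d r}, findShort ds = some (d, r) →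
    d.length ≤ 1 ∧ ds.Perm (d :: r) ∧ r.Sublist ds
  | [], _, _, h => by simp [findShort] at h
  | d :: ds, _, _, h => by
    rw [findShort] at h
    split_ifs at h with h1
    · cases h; exact ⟨h1, .refl _, List.sublist_cons_self _ _⟩
    · split at h
      · simp at h
      next h2 =>
        cases h
        obtain ⟨h3, h4, h5⟩ := findShort_some h2
        exact ⟨h3, (h4.cons d).trans (.swap _ _ _), h5.cons_cons _⟩

theorem findShort_length {ds : List (List Pos)} {d r} (h : findShort ds = some (d, r)) :
    ds.length = r.length + 1 := by
  simpa using (findShort_some h).2.1.length_eq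

/-- Unit propagation: `none` if it finds a contradiction, and otherwise the domains that remain. -/
def propagate (ds : List (List Pos)) : Option (List (List Pos)) :=
  match _h : findShort ds with
  | none => some ds
  | some ([], _) => none
  | some (q :: _, r) => propagate (filterApart q r)
termination_by ds.length
decreasing_by simp [findShort_length _h]

/-- A domain with a single element forces that element, so deleting the comparable positions
elsewhere loses no solution; an empty domain is a contradiction. -/
theorem sat_iff_propagate (ds : List (List Pos)) :
    Sat ds ↔ ∃ es, propagate ds = some es ∧ Sat es := by
  fun_induction propagate ds with
  | case1 => simp
  | case2 ds r h =>
    rw [sat_perm (findShort_some h).2.1]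
    simp [not_sat_nil_cons]
  | case3 ds q t r h ih =>
    obtain ⟨h1, h2, _⟩ := findShort_some h
    have ht : t = [] := by simpa using h1
    rw [← ih, sat_perm h2, sat_cons, ht]
    simp

theorem propagate_sublist {ds es : List (List Pos)} (h : propagate ds = some es) :
    (∀ d ∈ es, 2 ≤ d.length) ∧ ∃ r, r.Sublist ds ∧ List.Forall₂ List.Sublist es r := by
  fun_induction propagate ds with
  | case1 ds hf =>
    cases h
    exact ⟨findShort_none hf, _, .refl _, List.forall₂_same.2 fun _ _ => .refl _⟩
  | case2 => simp at h
  | case3 ds q t r hf ih =>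
    obtain ⟨h1, s, h2, h3⟩ := ih h
    refine ⟨h1, ?_⟩
    rw [filterApart, List.sublist_map_iff] at h2
    obtain ⟨s, h4, rfl⟩ := h2
    rw [List.forall₂_map_right_iff] at h3
    exact ⟨s, h4.trans (findShort_some hf).2.2, h3.imp fun _ _ h => h.trans List.filter_sublist⟩

/-- The total size of the domains. -/
def weight (ds : List (List Pos)) : ℕ := (ds.map (fun d => d.length + 1)).sum

theorem weight_filterApart (q : Pos) (ds : List (List Pos)) :
    weight (filterApart q ds) ≤ weight ds := by
  induction ds with
  | nil => simp [filterApart, weight]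
  | cons d ds ih =>
    have := List.length_filter_le (apart q) d
    simp only [filterApart, weight, List.map_cons, List.sum_cons] at *
    omega

theorem weight_propagate {ds es : List (List Pos)} (h : propagate ds = some es) :
    weight es ≤ weight ds := by
  obtain ⟨_, r, h1, h2⟩ := propagate_sublist h
  refine le_trans ?_ ((h1.map _).sum_le_sum (by simp))
  clear h1 h
  induction h2 with
  | nil => simp [weight]
  | cons h _ ih =>
    have := h.length_le
    simp only [weight, List.map_cons, List.sum_cons] at *
    have := ih (by simp_all)
    omega

/-- Limited backtracking for domains with at most two elements. -/
def solve (ds : List (List Pos)) : Bool :=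
  match ds with
  | [] => true
  | [] :: _ => false
  | (a :: d) :: r =>
    match _h : propagate (filterApart a r) with
    | some es => solve es
    | none => solve (d :: r)
termination_by weight ds
decreasing_by
  · have := weight_propagate _h
    have := weight_filterApart a r
    simp only [weight, List.map_cons, List.sum_cons, List.length_cons] at *
    omega
  · simp [weight]

/-- A surviving domain has at least two elements and started with at most two, so nothing was
deleted from it. Propagation therefore leaves a subfamily of the original problem. -/
theorem propagate_filterApart_sublist {q : Pos} {ds es : List (List Pos)}
    (hd : ∀ d ∈ ds, d.length ≤ 2) (h : propagate (filterApart q ds) = some es) :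
    es.Sublist ds := by
  obtain ⟨h1, r, h2, h3⟩ := propagate_sublist h
  rw [filterApart, List.sublist_map_iff] at h2
  obtain ⟨s, h2, rfl⟩ := h2
  rw [List.forall₂_map_right_iff] at h3
  suffices es = s by rwa [this]
  have hs : ∀ d ∈ s, d.length ≤ 2 := fun d hd' => hd d (h2.subset hd')
  clear h2 h
  induction h3 with
  | nil => rfl
  | @cons e d es ds h _ ih =>
    simp only [List.mem_cons, forall_eq_or_imp] at h1 hs
    rw [ih h1.2 hs.2, (h.trans List.filter_sublist).eq_of_length_le (by omega)]

/-- Committing to `a` is safe once propagation succeeds: a solution of the original problem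
restricts to the subfamily `es`, and a solution of `es` extends to one that uses `a`. If propagation
fails, no solution uses `a`, and it is dropped for good. -/
theorem solve_iff {ds : List (List Pos)} (hd : ∀ d ∈ ds, d.length ≤ 2) :
    solve ds = true ↔ Sat ds := by
  fun_induction solve ds with
  | case1 => simp [sat_nil]
  | case2 => simp [not_sat_nil_cons]
  | case3 a d r es h ih =>
    have hs := propagate_filterApart_sublist (fun d hd' => hd d (by simp [hd'])) h
    rw [ih fun d hd' => hd d (by simp [hs.subset hd'])]
    refine ⟨fun h' => sat_cons.2 ⟨a, by simp, (sat_iff_propagate _).2 ⟨es, h, h'⟩⟩, fun h' => ?_⟩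
    exact h'.sublist (hs.cons _)
  | case4 a d r h ih =>
    rw [ih, sat_cons, sat_cons]
    · have : ¬ Sat (filterApart a r) := by rw [sat_iff_propagate]; simp [h]
      simp [this]
    · intro e he
      rcases List.mem_cons.1 he with rfl | he
      · have := hd (a :: e) (by simp)
        simp at this; omega
      · exact hd e (by simp [he])

/-- Domains with at most three elements are taken in pairs: two elements of a pair of domains avoid
a common index. -/
def branch : List (List Pos) → List (List Pos) → Bool
  | [], ds => solve ds
  | [x], ds => solve (x.eraseIdx 0 :: ds) || (solve (x.eraseIdx 1 :: ds) ||
      solve (x.eraseIdx 2 :: ds))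
  | x :: y :: r, ds => branch r (x.eraseIdx 0 :: y.eraseIdx 0 :: ds) ||
      (branch r (x.eraseIdx 1 :: y.eraseIdx 1 :: ds) ||
        branch r (x.eraseIdx 2 :: y.eraseIdx 2 :: ds))

/-- Two indices cannot exhaust `0, 1, 2`. Deletion at an index past the end changes nothing, so
short domains need no separate treatment. -/
theorem exists_eraseIdx {x y : List Pos} {v w : Pos} (hv : v ∈ x) (hw : w ∈ y) :
    ∃ k < 3, v ∈ x.eraseIdx k ∧ w ∈ y.eraseIdx k := by
  obtain ⟨i, hi, rfl⟩ := List.getElem_of_mem hv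
  obtain ⟨j, hj, rfl⟩ := List.getElem_of_mem hw
  obtain ⟨k, hk, h1, h2⟩ : ∃ k < 3, i ≠ k ∧ j ≠ k := by
    by_cases h0 : i ≠ 0 ∧ j ≠ 0
    · exact ⟨0, by omega, h0⟩
    · by_cases h1 : i ≠ 1 ∧ j ≠ 1
      · exact ⟨1, by omega, h1⟩
      · exact ⟨2, by omega, by omega⟩
  exact ⟨k, hk, List.mem_eraseIdx_iff_getElem.2 ⟨i, hi, h1, rfl⟩,
    List.mem_eraseIdx_iff_getElem.2 ⟨j, hj, h2, rfl⟩⟩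

theorem length_eraseIdx_le_two {x : List Pos} {k : ℕ} (hx : x.length ≤ 3) (hk : k < 3) :
    (x.eraseIdx k).length ≤ 2 := by
  rw [List.length_eraseIdx]; split_ifs <;> omega

theorem sat_eraseIdx_cons {x : List Pos} {ds : List (List Pos)} :
    Sat (x :: ds) ↔ ∃ k < 3, Sat (x.eraseIdx k :: ds) := by
  constructor
  · rintro ⟨_, _ | ⟨h1, h2⟩, h3⟩
    obtain ⟨k, hk, h4, _⟩ := exists_eraseIdx h1 h1
    exact ⟨k, hk, _, .cons h4 h2, h3⟩
  · rintro ⟨k, _, h⟩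
    exact h.mono (.cons (List.eraseIdx_subset ..)
      (List.forall₂_same.2 fun _ _ => List.Subset.refl _))

theorem sat_eraseIdx_cons_cons {x y : List Pos} {ds : List (List Pos)} :
    Sat (x :: y :: ds) ↔ ∃ k < 3, Sat (x.eraseIdx k :: y.eraseIdx k :: ds) := by
  constructor
  · rintro ⟨_, _ | ⟨h1, _ | ⟨h2, h3⟩⟩, h4⟩
    obtain ⟨k, hk, h5, h6⟩ := exists_eraseIdx h1 h2
    exact ⟨k, hk, _, .cons h5 (.cons h6 h3), h4⟩
  · rintro ⟨k, _, h⟩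
    exact h.mono (.cons (List.eraseIdx_subset ..) (.cons (List.eraseIdx_subset ..)
      (List.forall₂_same.2 fun _ _ => List.Subset.refl _)))

theorem exists_lt_three {p : ℕ → Prop} : (∃ k < 3, p k) ↔ p 0 ∨ p 1 ∨ p 2 := by
  constructor
  · rintro ⟨k, hk, h⟩; interval_cases k <;> simp [h]
  · rintro (h | h | h)
    exacts [⟨0, by simp, h⟩, ⟨1, by simp, h⟩, ⟨2, by simp, h⟩]

theorem branch_iff {ds es : List (List Pos)} (hd : ∀ d ∈ ds, d.length ≤ 3)
    (he : ∀ e ∈ es, e.length ≤ 2) : branch ds es = true ↔ Sat (ds ++ es) := by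
  fun_induction branch ds es with
  | case1 => exact solve_iff he
  | case2 x es =>
    have hx := hd x (by simp)
    rw [List.singleton_append, sat_eraseIdx_cons, exists_lt_three, Bool.or_eq_true,
      Bool.or_eq_true, solve_iff, solve_iff, solve_iff] <;>
    · exact List.forall_mem_cons.2 ⟨length_eraseIdx_le_two hx (by norm_num), he⟩
  | case3 x y r es ih₁ ih₂ ih₃ =>
    have hx := hd x (by simp)
    have hy := hd y (by simp)
    have hr : ∀ d ∈ r, d.length ≤ 3 := fun d h => hd d (by simp [h])
    have hm : ∀ k, Sat (r ++ x.eraseIdx k :: y.eraseIdx k :: es) ↔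
        Sat (x.eraseIdx k :: y.eraseIdx k :: (r ++ es)) := fun k =>
      sat_perm (List.perm_middle.trans (List.perm_middle.cons _))
    rw [List.cons_append, List.cons_append, sat_eraseIdx_cons_cons, exists_lt_three,
      Bool.or_eq_true, Bool.or_eq_true, ih₁ hr, ih₂ hr, ih₃ hr, hm, hm, hm] <;>
    · exact List.forall_mem_cons.2 ⟨length_eraseIdx_le_two hx (by norm_num),
        List.forall_mem_cons.2 ⟨length_eraseIdx_le_two hy (by norm_num), he⟩⟩

/-! ## Minimal positions of embeddings -/

/-- The domains restricted to the proper descendants of `p`. -/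
def filterBelow (p : Pos) (ds : List (List Pos)) : List (List Pos) :=
  ds.map (List.filter (below p))

/-- The positions with label `a` below which the given domains are satisfiable. -/
def scan [DecidableEq Λ] (a : Λ) (ds : List (List Pos)) : List (Pos × Λ) → List Pos
  | [] => []
  | (p, b) :: L => if b = a then
      (if branch (filterBelow p ds) [] then p :: scan a ds L else scan a ds L) else scan a ds L

/-- The positions in `ps` without a proper descendant in `qs`. -/
def lowest (qs ps : List Pos) : List Pos := ps.filter fun p => !qs.any (below p)

/-- The minimal positions at which a tree can be embedded. -/
def cands [DecidableEq Λ] (L : List (Pos × Λ)) : LTree Λ → List Pos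
  | .node a cs => lowest (scan a (cs.map (cands L)) L) (scan a (cs.map (cands L)) L)

theorem mem_scan [DecidableEq Λ] {a : Λ} {ds : List (List Pos)} {p : Pos} :
    ∀ {L : List (Pos × Λ)}, p ∈ scan a ds L ↔ (p, a) ∈ L ∧ branch (filterBelow p ds) [] = true
  | [] => by simp [scan]
  | (q, b) :: L => by
    rw [scan]
    split_ifs with h1 h2
    · subst h1
      simp only [List.mem_cons, mem_scan (L := L), Prod.mk.injEq, and_true]
      constructor
      · rintro (rfl | h)
        · exact ⟨.inl rfl, h2⟩
        · exact ⟨.inr h.1, h.2⟩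
      · rintro ⟨rfl | h, h'⟩
        · exact .inl rfl
        · exact .inr ⟨h, h'⟩
    · subst h1
      simp only [List.mem_cons, mem_scan (L := L), Prod.mk.injEq, and_true]
      refine and_congr_left fun h => ⟨.inr, ?_⟩
      rintro (rfl | h')
      · exact absurd h h2
      · exact h'
    · simp only [List.mem_cons, mem_scan (L := L), Prod.mk.injEq]
      simp [Ne.symm h1]

theorem sat_filterBelow {p : Pos} {ds : List (List Pos)} :
    Sat (filterBelow p ds) ↔ ∃ vs, List.Forall₂ (fun d v => v ∈ d ∧ below p v = true) ds vs ∧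
      vs.Pairwise (fun v w => apart v w = true) := by
  simp only [Sat, filterBelow, List.forall₂_map_left_iff, List.mem_filter]

/-- A longest member of `qs` that extends `p` has no proper descendant in `qs`. -/
theorem exists_lowest {qs : List Pos} : ∀ {p : Pos}, p ∈ qs → ∃ q ∈ lowest qs qs, p <+: q := by
  intro p hp
  obtain ⟨q, hq, hmax⟩ := (qs.toFinset.filter (p <+: ·)).exists_max_image List.length
    ⟨p, by simpa using hp⟩
  simp only [Finset.mem_filter, List.mem_toFinset] at hq hmax
  refine ⟨q, List.mem_filter.2 ⟨hq.1, ?_⟩, hq.2⟩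
  rw [Bool.not_eq_true', List.any_eq_false]
  intro r hr hb
  have h := below_iff.1 hb
  exact h.2 (h.1.eq_of_length_le (hmax r ⟨hr, hq.2.trans h.1⟩))

theorem apart_of_mem_lowest {qs : List Pos} {p q : Pos} (hp : p ∈ lowest qs qs)
    (hq : q ∈ lowest qs qs) (h : p ≠ q) : apart p q = true := by
  have key : ∀ {p q : Pos}, p ∈ lowest qs qs → q ∈ lowest qs qs → p ≠ q → ¬ p <+: q := by
    intro p q hp hq h hpq
    rw [lowest, List.mem_filter, Bool.not_eq_true', List.any_eq_false] at hp
    exact hp.2 q (List.mem_filter.1 hq).1 (below_iff.2 ⟨hpq, h⟩)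
  exact apart_iff.2 ⟨key hp hq h, key hq hp h.symm⟩

/-! ### Leaf labels and the number of candidates -/

theorem exists_mem_leafLabels (u : LTree Λ) : ∃ a, a ∈ u.leafLabels := by
  induction u using LTree.induction with
  | node a cs ih =>
    cases cs with
    | nil => exact ⟨a, by simp [LTree.leafLabels]⟩
    | cons c cs =>
      obtain ⟨b, hb⟩ := ih c (by simp)
      exact ⟨b, by simp [LTree.leafLabels, hb]⟩

theorem leafLabels_child {a : Λ} {c : LTree Λ} {cs : List (LTree Λ)} (hc : c ∈ cs) {b : Λ}
    (hb : b ∈ c.leafLabels) : b ∈ (LTree.node a cs).leafLabels := by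
  rw [LTree.leafLabels]
  cases cs with
  | nil => simp at hc
  | cons d cs =>
    simp only [List.isEmpty_cons, Bool.false_eq_true, if_false, List.mem_flatten, List.mem_map]
    exact ⟨_, ⟨c, hc, rfl⟩, hb⟩

theorem emb_leafLabels {L : List (Pos × Λ)} {u : LTree Λ} : ∀ {p : Pos}, Emb L u p →
    ∀ b ∈ u.leafLabels, ∃ q, p <+: q ∧ (q, b) ∈ L := by
  induction u using LTree.induction with
  | node a cs ih =>
    intro p h b hb
    rw [emb_node] at h
    obtain ⟨h1, vs, h2, h3⟩ := h
    clear h3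
    rw [LTree.leafLabels] at hb
    split_ifs at hb with hcs
    · exact ⟨p, List.prefix_rfl, by simpa [List.mem_singleton.1 hb] using h1⟩
    · simp only [List.mem_flatten, List.mem_map] at hb
      obtain ⟨_, ⟨c, hc, rfl⟩, hb⟩ := hb
      obtain ⟨v, hv, hbv⟩ : ∃ v, Emb L c v ∧ below p v = true := by
        clear ih hcs
        induction h2 with
        | nil => simp at hc
        | cons h _ ih =>
          rcases List.mem_cons.1 hc with rfl | hc
          · exact ⟨_, h⟩
          · exact ih hc
      obtain ⟨q, hq, hqL⟩ := ih c hc hv b hb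
      exact ⟨q, (below_iff.1 hbv).1.trans hq, hqL⟩

theorem nodup_scan [DecidableEq Λ] {a : Λ} {ds : List (List Pos)} {L : List (Pos × Λ)}
    (hL : (L.map Prod.fst).Nodup) : (scan a ds L).Nodup := by
  refine hL.sublist ?_
  clear hL
  induction L with
  | nil => simp [scan]
  | cons x L ih =>
    obtain ⟨p, b⟩ := x
    rw [scan]
    split_ifs
    · exact ih.cons_cons _
    · exact ih.cons _
    · exact ih.cons _

/-- Each position selects an occurrence of `b` at or below it. Incomparable positions have no common
extension, so the selection is injective. -/
theorem length_le_count [DecidableEq Λ] {L : List (Pos × Λ)} {ps : List Pos} (hn : ps.Nodup) {b : Λ}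
    (h : ∀ p ∈ ps, ∃ q, p <+: q ∧ (q, b) ∈ L)
    (ha : ∀ p ∈ ps, ∀ q ∈ ps, p ≠ q → apart p q = true) :
    ps.length ≤ (L.map Prod.snd).count b := by
  choose! f hf using h
  have h1 : (ps.map f).Nodup := by
    refine List.Nodup.map_on (fun p hp q hq hpq => ?_) hn
    by_contra hne
    have := apart_iff.1 (apart_mono (ha p hp q hq hne) (hf p hp).1 (hf q hq).1)
    exact this.1 (by rw [hpq])
  have h2 : (ps.map f).Subperm ((L.filter (fun x => x.2 = b)).map Prod.fst) := by
    refine List.subperm_of_subset h1 fun q hq => ?_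
    obtain ⟨p, hp, rfl⟩ := List.mem_map.1 hq
    exact List.mem_map.2 ⟨_, List.mem_filter.2 ⟨(hf p hp).2, by simp⟩, rfl⟩
  have h3 := h2.length_le
  rw [List.length_map, List.length_map, ← List.countP_eq_length_filter] at h3
  refine h3.trans (le_of_eq ?_)
  rw [List.count, List.countP_map]
  exact List.countP_congr fun x _ => by simp

/-- The hypotheses on the labeled positions and on the pattern. -/
structure Bounded [DecidableEq Λ] (L : List (Pos × Λ)) (u : LTree Λ) : Prop where
  nodup : (L.map Prod.fst).Nodup
  count_le : ∀ a ∈ u.leafLabels, (L.map Prod.snd).count a ≤ 3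

theorem Bounded.child [DecidableEq Λ] {L : List (Pos × Λ)} {a : Λ} {c : LTree Λ}
    {cs : List (LTree Λ)} (h : Bounded L (.node a cs)) (hc : c ∈ cs) : Bounded L c :=
  ⟨h.nodup, fun b hb => h.count_le b (leafLabels_child hc hb)⟩

/-- The three claims need one joint induction: the length bound for the children makes `branch`
correct, and the first two claims for the children make its answer equivalent to an embedding at
`p`. -/
theorem cands_spec [DecidableEq Λ] {L : List (Pos × Λ)} (u : LTree Λ) (h : Bounded L u) :
    (∀ p ∈ cands L u, Emb L u p) ∧ (∀ p, Emb L u p → ∃ q ∈ cands L u, p <+: q) ∧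
      (cands L u).length ≤ 3 := by
  induction u using LTree.induction with
  | node a cs ih =>
    have hm : ∀ p, p ∈ scan a (cs.map (cands L)) L ↔ Emb L (.node a cs) p := by
      intro p
      rw [mem_scan, branch_iff _ (by simp), List.append_nil, sat_filterBelow, emb_node]
      · refine and_congr_right fun _ => ⟨?_, ?_⟩
        · rintro ⟨vs, h1, h2⟩
          refine ⟨vs, ?_, h2⟩
          rw [List.forall₂_map_left_iff] at h1
          rw [List.forall₂_iff_get] at h1 ⊢
          exact ⟨h1.1, fun i hi hi' => ⟨(ih _ (List.get_mem _ _) (h.child (List.get_mem _ _))).1 _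
            (h1.2 i hi hi').1, (h1.2 i hi hi').2⟩⟩
        · rintro ⟨vs, h1, h2⟩
          -- Each image of a child is replaced by a candidate at or below it; the replacements stay
          -- below `p` and, by `apart_mono`, pairwise incomparable.
          have : ∃ ws, List.Forall₂ (fun d v => v ∈ d ∧ below p v = true) (cs.map (cands L)) ws ∧
              List.Forall₂ (· <+: ·) vs ws := by
            clear h2
            have hc : ∀ c ∈ cs, Bounded L c := fun c => h.child
            clear h
            induction h1 with
            | nil => exact ⟨[], .nil, .nil⟩
            | @cons c v cs vs h1 _ ih' =>
              obtain ⟨ws, h3, h4⟩ := ih' (fun c hc => ih c (by simp [hc]))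
                (fun c hc' => hc c (by simp [hc']))
              obtain ⟨w, hw, hvw⟩ := (ih c (by simp) (hc c (by simp))).2.1 v h1.1
              exact ⟨w :: ws, .cons ⟨hw, below_of_below_of_prefix h1.2 hvw⟩ h3, .cons hvw h4⟩
          obtain ⟨ws, h3, h4⟩ := this
          refine ⟨ws, h3, ?_⟩
          clear h1 h3
          induction h4 with
          | nil => exact .nil
          | @cons v w vs ws h5 h6 ih' =>
            rw [List.pairwise_cons] at h2 ⊢
            refine ⟨fun w' hw' => ?_, ih' h2.2⟩
            obtain ⟨v', hv', h7⟩ : ∃ v' ∈ vs, v' <+: w' := by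
              obtain ⟨i, hi, rfl⟩ := List.getElem_of_mem hw'
              rw [List.forall₂_iff_get] at h6
              exact ⟨vs[i]'(h6.1 ▸ hi), List.getElem_mem _, h6.2 i _ _⟩
            exact apart_mono (h2.1 v' hv') h5 h7
      · intro d hd
        simp only [filterBelow, List.map_map, List.mem_map, Function.comp] at hd
        obtain ⟨c, hc, rfl⟩ := hd
        exact (List.length_filter_le _ _).trans (ih c hc (h.child hc)).2.2
    have hemb : ∀ p ∈ cands L (.node a cs), Emb L (.node a cs) p := fun p hp => by
      rw [cands, lowest, List.mem_filter] at hp; exact (hm p).1 hp.1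
    refine ⟨hemb, fun p hp => ?_, ?_⟩
    · rw [cands]; exact exists_lowest ((hm p).2 hp)
    -- A single leaf label of the subtree suffices for the count.
    · obtain ⟨b, hb⟩ := exists_mem_leafLabels (LTree.node a cs)
      refine (length_le_count ?_ (fun p hp => emb_leafLabels (hemb p hp) b hb) ?_).trans
        (h.count_le b hb)
      · rw [cands]; exact (nodup_scan h.nodup).filter _
      · rw [cands]; exact fun p hp q hq => apart_of_mem_lowest hp hq

/-! ### The node list of a tree -/

theorem nodup_nodes : ∀ ts : List (LTree Λ), ((nodes ts).map Prod.fst).Nodup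
  | [] => by simp [nodes]
  | .node a cs :: ts => by
    simp only [nodes, List.map_cons, List.map_append, List.map_map, List.nodup_cons,
      List.nodup_append]
    refine ⟨?_, ?_, ?_, ?_⟩
    · simp only [List.mem_append, List.mem_map, Function.comp]
      rintro (⟨x, hx, h⟩ | ⟨x, _, h⟩)
      · exact nodes_ne_nil hx (by simpa using h)
      · simp at h
    · have := (nodup_nodes cs).map (f := (false :: ·)) (List.cons_injective)
      rwa [List.map_map] at this
    · have := (nodup_nodes ts).map (f := (true :: ·)) (List.cons_injective)
      rwa [List.map_map] at this
    · simp only [List.mem_map, Function.comp]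
      rintro _ ⟨x, _, rfl⟩ _ ⟨y, _, rfl⟩
      simp

theorem map_snd_nodes : ∀ ts : List (LTree Λ),
    (nodes ts).map Prod.snd = (ts.map LTree.labels).flatten
  | [] => by simp [nodes]
  | .node a cs :: ts => by
    have h1 := map_snd_nodes cs
    have h2 := map_snd_nodes ts
    simp only [nodes, List.map_cons, List.map_append, List.map_map, List.flatten_cons,
      LTree.labels, ← h1, ← h2]
    rfl

theorem length_nodes (T : LTree Λ) : (nodes [T]).length = T.size := by
  rw [LTree.size, ← List.length_map (f := Prod.snd), map_snd_nodes]; simp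

theorem length_le_of_mem_nodes : ∀ {ts : List (LTree Λ)} {x : Pos × Λ}, x ∈ nodes ts →
    x.1.length ≤ (nodes ts).length
  | [], _, h => by simp [nodes] at h
  | .node a cs :: ts, x, h => by
    simp only [nodes, List.mem_cons, List.mem_append, List.mem_map] at h
    simp only [nodes, List.length_cons, List.length_append, List.length_map]
    rcases h with rfl | ⟨y, hy, rfl⟩ | ⟨y, hy, rfl⟩
    · simp
    · have := length_le_of_mem_nodes hy; simp; omega
    · have := length_le_of_mem_nodes hy; simp; omega

theorem bounded_nodes [DecidableEq Λ] {P T : LTree Λ}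
    (h : ∀ a ∈ P.leafLabels, T.labels.count a ≤ 3) : Bounded (nodes [T]) P :=
  ⟨nodup_nodes _, by simpa [map_snd_nodes] using h⟩

theorem included_iff_cands [DecidableEq Λ] {P T : LTree Λ}
    (h : ∀ a ∈ P.leafLabels, T.labels.count a ≤ 3) :
    P.Included T ↔ cands (nodes [T]) P ≠ [] := by
  obtain ⟨h1, h2, _⟩ := cands_spec P (bounded_nodes h)
  rw [included_iff]
  constructor
  · rintro ⟨p, hp⟩
    obtain ⟨q, hq, _⟩ := h2 p hp
    exact List.ne_nil_of_mem hq
  · intro h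
    obtain ⟨q, hq⟩ := List.exists_mem_of_ne_nil _ h
    exact ⟨q, h1 q hq⟩

/-! ## The program -/

namespace Prog

open Exp

/-- Access to the two components of the argument of a function. -/
def unpack (e : Exp) : Exp := case (var 0) nil nil e

/-- The value `true`. -/
def yes : Exp := pair nil nil

/-- Disjunction. -/
def or (e₁ e₂ : Exp) : Exp := case e₁ e₂ nil yes

/-- The body of function `i` that filters a list by function `f`. -/
def filter (f i : ℕ) : Exp :=
  unpack (case (var 1) nil nil (bind (call i (pair (var 2) (var 1)))
    (case (call f (pair (var 3) (var 1))) (var 0) nil (pair (var 3) (var 2)))))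

/-- The body of function `i` that maps function `f` over a list. -/
def map (f i : ℕ) : Exp :=
  unpack (case (var 1) nil nil
    (pair (call f (pair (var 2) (var 0))) (call i (pair (var 2) (var 1)))))

/-- Numbers after `call` are indices into `prog`. Directly under `unpack`, `var 0` and `var 1` are
the components of the argument and `var 2` is the argument itself. The node list is started with the
forest `[T]`, the empty path and an empty accumulator. -/
def main : Exp :=
  unpack (bind (call 2 (pair (pair (var 1) nil) (pair nil nil)))
    (bind (call 19 (pair (var 1) (var 0))) (case (var 0) nil nil yes)))

def snoc : Exp :=
  unpack (case (var 0) (pair (var 1) nil) nil (pair (var 0) (call 1 (pair (var 1) (var 3)))))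

/-- The argument is a forest, a path and an accumulator. The later trees are listed first, and their
list becomes the accumulator for the children, so that no lists are concatenated. -/
def nodes : Exp :=
  unpack (case (var 1) nil nil (case (var 2) (var 1) nil (case (var 0) nil nil
    (bind (call 1 (pair (var 4) yes))
    (bind (call 2 (pair (var 4) (pair (var 0) (var 6))))
    (bind (call 1 (pair (var 6) nil))
    (pair (pair (var 0) (var 3)) (call 2 (pair (var 4) (pair (var 0) (var 1)))))))))))

def below : Exp :=
  unpack (case (var 0) (case (var 1) nil nil yes) nil (case (var 3) nil nil
    (case (var 0) (case (var 2) (call 3 (pair (var 3) (var 1))) nil nil) nil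
      (case (var 4) nil nil (call 3 (pair (var 7) (var 5)))))))

def apart : Exp :=
  unpack (case (var 0) nil nil (case (var 3) nil nil
    (case (var 0) (case (var 2) (call 4 (pair (var 3) (var 1))) nil yes) nil
      (case (var 4) yes nil (call 4 (pair (var 7) (var 5)))))))

def findShort : Exp :=
  case (var 0) nil nil (case (var 0) (pair (var 0) (var 1)) nil
    (case (var 1) (pair (var 2) (var 3)) nil (bind (call 9 (var 5))
      (case (var 0) nil nil (pair (var 0) (pair (var 7) (var 1)))))))

/-- A contradiction yields `nil`; success is wrapped in a pair so that an empty list of remaining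
domains stays distinguishable from it. -/
def propagate : Exp :=
  bind (call 9 (var 0)) (case (var 0) (pair nil (var 1)) nil
    (case (var 0) nil nil (call 10 (call 8 (pair (var 0) (var 3))))))

def solve : Exp :=
  case (var 0) yes nil (case (var 0) nil nil
    (bind (call 10 (call 8 (pair (var 0) (var 3))))
      (case (var 0) (call 11 (pair (var 2) (var 4))) nil (call 11 (var 1)))))

def erase0 : Exp := case (var 0) nil nil (var 1)

def erase1 : Exp := case (var 0) nil nil (pair (var 0) (call 12 (var 1)))

def erase2 : Exp := case (var 0) nil nil (pair (var 0) (call 13 (var 1)))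

/-- The recursive call of `branch` that removes an element from two domains by function `f`. -/
def branchPair (f : ℕ) : Exp :=
  call 15 (pair (var 1) (pair (call f (var 2)) (pair (call f (var 0)) (var 5))))

/-- The call of `solve` in `branch` that removes an element from the last domain. -/
def branchLast (f : ℕ) : Exp := call 11 (pair (call f (var 0)) (var 3))

def branch : Exp :=
  unpack (case (var 0) (call 11 (var 1)) nil (case (var 1)
    (or (branchLast 12) (or (branchLast 13) (branchLast 14))) nil
    (or (branchPair 12) (or (branchPair 13) (branchPair 14)))))

def scan : Exp :=
  unpack (case (var 1) nil nil (case (var 2) nil nil (bind (call 16 (pair (var 1) (var 5)))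
    (case (var 1) nil nil (ifEq (var 1) (var 5)
      (case (call 15 (pair (call 6 (pair (var 0) (var 6))) nil)) (var 2) nil
        (pair (var 2) (var 4)))
      (var 2))))))

/-- The list comes before the position because `filter` passes its fixed argument first. -/
def noneBelow : Exp :=
  unpack (case (var 0) yes nil
    (case (call 3 (pair (var 3) (var 0))) (call 17 (pair (var 1) (var 3))) nil nil))

def cands : Exp :=
  unpack (case (var 0) nil nil (bind (call 20 (pair (var 1) (var 3)))
    (bind (call 16 (pair (var 4) (pair (var 1) (var 0)))) (call 18 (pair (var 0) (var 0))))))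

def candsList : Exp :=
  unpack (case (var 0) nil nil
    (pair (call 19 (pair (var 0) (var 3))) (call 20 (pair (var 1) (var 3)))))

/-- The decision program for tree inclusion. -/
def prog : Program :=
  [main, snoc, nodes, below, apart, filter 3 5, map 5 6, filter 4 7, map 7 8, findShort, propagate,
    solve, erase0, erase1, erase2, branch, scan, noneBelow, filter 17 18, cands, candsList]

end Prog

/-! ## Evaluation with an upper bound on the number of steps -/

/-- In the environment `env`, `e` evaluates to `v` in at most `b` steps. -/
def Ev (env : List (Val Λ)) (e : Exp) (v : Val Λ) (b : ℕ) : Prop :=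
  ∃ t ≤ b, Eval Prog.prog env e v t

/-- Function `f` maps `x` to `y` in at most `b` steps. -/
def Fn (f : ℕ) (x y : Val Λ) (b : ℕ) : Prop :=
  ∃ body, Prog.prog[f]? = some body ∧ Ev [x] body y b

section

variable {env : List (Val Λ)} {e e₀ e₁ e₂ : Exp} {v w x y : Val Λ} {b s t : ℕ}

theorem Ev.le (h : Ev env e v s) (hs : s ≤ b) : Ev env e v b := by
  obtain ⟨t, ht, h⟩ := h; exact ⟨t, ht.trans hs, h⟩

theorem Fn.le {f : ℕ} (h : Fn f x y s) (hs : s ≤ b) : Fn f x y b := by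
  obtain ⟨body, h1, h2⟩ := h; exact ⟨body, h1, h2.le hs⟩

theorem Ev.var {i : ℕ} (h : env[i]? = some v) : Ev env (.var i) v 1 := ⟨1, le_rfl, .var h⟩

theorem Ev.nil : Ev env .nil .nil 1 := ⟨1, le_rfl, .nil⟩

theorem Ev.pair (h₁ : Ev env e₁ x s) (h₂ : Ev env e₂ y t) :
    Ev env (.pair e₁ e₂) (.pair x y) (s + t + 1) := by
  obtain ⟨s', hs, h₁⟩ := h₁
  obtain ⟨t', ht, h₂⟩ := h₂
  exact ⟨_, by omega, .pair h₁ h₂⟩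

theorem Ev.case_nil (h : Ev env e .nil s) (h₀ : Ev env e₀ v t) :
    Ev env (.case e e₀ e₁ e₂) v (s + t + 1) := by
  obtain ⟨s', hs, h⟩ := h
  obtain ⟨t', ht, h₀⟩ := h₀
  exact ⟨_, by omega, .case_nil h h₀⟩

theorem Ev.case_pair (h : Ev env e (.pair x y) s) (h₂ : Ev (x :: y :: env) e₂ v t) :
    Ev env (.case e e₀ e₁ e₂) v (s + t + 1) := by
  obtain ⟨s', hs, h⟩ := h
  obtain ⟨t', ht, h₂⟩ := h₂
  exact ⟨_, by omega, .case_pair h h₂⟩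

theorem Ev.ifEq_true {e₃ : Exp} {a : Λ} {r : ℕ} (h : Ev env e (.atom a) s)
    (h₁ : Ev env e₁ (.atom a) t) (h₂ : Ev env e₂ v r) :
    Ev env (.ifEq e e₁ e₂ e₃) v (s + t + r + 1) := by
  obtain ⟨s', hs, h⟩ := h
  obtain ⟨t', ht, h₁⟩ := h₁
  obtain ⟨r', hr, h₂⟩ := h₂
  exact ⟨_, by omega, .ifEq_true h h₁ h₂⟩

theorem Ev.ifEq_false {e₃ : Exp} {a c : Λ} {r : ℕ} (h : Ev env e (.atom a) s)
    (h₁ : Ev env e₁ (.atom c) t) (hne : a ≠ c) (h₂ : Ev env e₃ v r) :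
    Ev env (.ifEq e e₁ e₂ e₃) v (s + t + r + 1) := by
  obtain ⟨s', hs, h⟩ := h
  obtain ⟨t', ht, h₁⟩ := h₁
  obtain ⟨r', hr, h₂⟩ := h₂
  refine ⟨_, by omega, .ifEq_false h h₁ ?_ h₂⟩
  rintro ⟨d, h, h'⟩
  cases h; cases h'; exact hne rfl

theorem Ev.bind (h : Ev env e v s) (h₁ : Ev (v :: env) e₁ w t) :
    Ev env (.bind e e₁) w (s + t + 1) := by
  obtain ⟨s', hs, h⟩ := h
  obtain ⟨t', ht, h₁⟩ := h₁
  exact ⟨_, by omega, .bind h h₁⟩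

theorem Ev.call {f : ℕ} (hf : Fn f x y t) (h : Ev env e x s) :
    Ev env (.call f e) y (s + t + 1) := by
  obtain ⟨body, hb, t', ht, hf⟩ := hf
  obtain ⟨s', hs, h⟩ := h
  exact ⟨_, by omega, .call hb h hf⟩

theorem Ev.case_bool {c : Bool} (h : Ev env e (Val.ofBool c) s) (h₀ : c = false → Ev env e₀ v t)
    (h₂ : c = true → Ev (.nil :: .nil :: env) e₂ v t) :
    Ev env (.case e e₀ e₁ e₂) v (s + t + 1) := by
  cases c
  · exact .case_nil h (h₀ rfl)
  · exact .case_pair h (h₂ rfl)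

theorem Ev.yes : Ev env Prog.yes (Val.ofBool true) 3 := .pair .nil .nil

theorem Ev.or {c d : Bool} (h : Ev env e (Val.ofBool c) s) (h₁ : Ev env e₁ (Val.ofBool d) t) :
    Ev env (Prog.or e e₁) (Val.ofBool (c || d)) (s + t + 4) := by
  refine .le (.case_bool h (t := t + 3) ?_ ?_) (by omega)
  · rintro rfl; exact h₁.le (by omega)
  · rintro rfl; exact Ev.yes.le (by omega)

theorem Fn.unpack {f : ℕ} (h : Prog.prog[f]? = some (Prog.unpack e))
    (he : Ev [x, y, .pair x y] e v s) (hb : s + 2 ≤ b) : Fn f (.pair x y) v b :=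
  ⟨_, h, .le (.case_pair (.var rfl) he) (by omega)⟩

theorem Fn.filter {α : Type} {enc : α → Val Λ} {p : α → Bool} {f i : ℕ}
    (hi : Prog.prog[i]? = some (Prog.filter f i)) : ∀ {l : List α},
    (∀ a ∈ l, Fn f (.pair x (enc a)) (Val.ofBool (p a)) b) →
    Fn i (.pair x (Val.ofList (l.map enc))) (Val.ofList ((l.filter p).map enc))
      ((l.length + 1) * (b + 20))
  | [], _ => .unpack hi (.case_nil (.var rfl) .nil) (by simp)
  | a :: l, h => by
    refine .unpack hi (.case_pair (.var rfl) (.bind (.call (Fn.filter hi (l := l)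
      (fun a ha => h a (by simp [ha]))) (.pair (.var rfl) (.var rfl)))
      (.case_bool (t := 3) (.call (h a (by simp)) (.pair (.var rfl) (.var rfl))) ?_ ?_))) ?_
    · intro ha
      rw [List.filter_cons_of_neg (by simp [ha])]
      exact .le (.var rfl) (by omega)
    · intro ha
      rw [List.filter_cons_of_pos ha]
      exact .pair (.var rfl) (.var rfl)
    · simp only [List.length_cons]; linarith

theorem Fn.map {α : Type} {enc : α → Val Λ} {g : α → α} {f i : ℕ}
    (hi : Prog.prog[i]? = some (Prog.map f i)) : ∀ {l : List α},
    (∀ a ∈ l, Fn f (.pair x (enc a)) (enc (g a)) b) →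
    Fn i (.pair x (Val.ofList (l.map enc))) (Val.ofList ((l.map g).map enc))
      ((l.length + 1) * (b + 20))
  | [], _ => .unpack hi (.case_nil (.var rfl) .nil) (by simp)
  | a :: l, h => by
    refine .unpack hi (.case_pair (.var rfl) (.pair
      (.call (h a (by simp)) (.pair (.var rfl) (.var rfl)))
      (.call (Fn.map hi (l := l) (fun a ha => h a (by simp [ha]))) (.pair (.var rfl) (.var rfl)))))
      ?_
    simp only [List.length_cons]; linarith

end

/-! ## Positions and nodes -/

/-- The value of a position. -/
def encPos (p : Pos) : Val Λ := Val.ofList (p.map Val.ofBool)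

/-- The value of a list of positions. -/
def encDom (d : List Pos) : Val Λ := Val.ofList (d.map encPos)

/-- The value of a list of lists of positions. -/
def encDoms (ds : List (List Pos)) : Val Λ := Val.ofList (ds.map encDom)

/-- The value of a labeled position. -/
def encNode (x : Pos × Λ) : Val Λ := .pair (encPos x.1) (.atom x.2)

theorem fn_below : ∀ p q : Pos,
    Fn (Λ := Λ) 3 (.pair (encPos p) (encPos q)) (Val.ofBool (below p q)) (30 * (p.length + 1))
  | [], [] => .unpack rfl (.case_nil (.var rfl) (.case_nil (.var rfl) .nil)) (by simp)
  | [], _ :: _ => .unpack rfl (.case_nil (.var rfl) (.case_pair (.var rfl) .yes)) (by simp)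
  | _ :: _, [] => .unpack rfl (.case_pair (.var rfl) (.case_nil (.var rfl) .nil)) (by omega)
  | false :: p, false :: q => .unpack rfl (.case_pair (.var rfl) (.case_pair (.var rfl)
      (.case_nil (.var rfl) (.case_nil (.var rfl)
        (.call (fn_below p q) (.pair (.var rfl) (.var rfl)))))))
      (by simp only [List.length_cons]; omega)
  | false :: p, true :: q => .unpack rfl (.case_pair (.var rfl) (.case_pair (.var rfl)
      (.case_pair (.var rfl) (.case_nil (.var rfl) .nil))))
      (by simp only [List.length_cons]; omega)
  | true :: p, false :: q => .unpack rfl (.case_pair (.var rfl) (.case_pair (.var rfl)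
      (.case_nil (.var rfl) (.case_pair (.var rfl) .nil))))
      (by simp only [List.length_cons]; omega)
  | true :: p, true :: q => .unpack rfl (.case_pair (.var rfl) (.case_pair (.var rfl)
      (.case_pair (.var rfl) (.case_pair (.var rfl)
        (.call (fn_below p q) (.pair (.var rfl) (.var rfl)))))))
      (by simp only [List.length_cons]; omega)

theorem fn_apart : ∀ p q : Pos,
    Fn (Λ := Λ) 4 (.pair (encPos p) (encPos q)) (Val.ofBool (apart p q)) (30 * (p.length + 1))
  | [], q => .unpack rfl (.case_nil (.var rfl) .nil) (by simp)
  | _ :: _, [] => .unpack rfl (.case_pair (.var rfl) (.case_nil (.var rfl) .nil)) (by omega)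
  | false :: p, false :: q => .unpack rfl (.case_pair (.var rfl) (.case_pair (.var rfl)
      (.case_nil (.var rfl) (.case_nil (.var rfl)
        (.call (fn_apart p q) (.pair (.var rfl) (.var rfl)))))))
      (by simp only [List.length_cons]; omega)
  | false :: p, true :: q => .unpack rfl (.case_pair (.var rfl) (.case_pair (.var rfl)
      (.case_pair (.var rfl) (.case_nil (.var rfl) .yes))))
      (by simp only [List.length_cons]; omega)
  | true :: p, false :: q => .unpack rfl (.case_pair (.var rfl) (.case_pair (.var rfl)
      (.case_nil (.var rfl) (.case_pair (.var rfl) .yes))))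
      (by simp only [List.length_cons]; omega)
  | true :: p, true :: q => .unpack rfl (.case_pair (.var rfl) (.case_pair (.var rfl)
      (.case_pair (.var rfl) (.case_pair (.var rfl)
        (.call (fn_apart p q) (.pair (.var rfl) (.var rfl)))))))
      (by simp only [List.length_cons]; omega)

theorem fn_snoc (b : Bool) : ∀ p : Pos,
    Fn (Λ := Λ) 1 (.pair (encPos p) (Val.ofBool b)) (encPos (p ++ [b])) (10 * (p.length + 1))
  | [] => .unpack rfl (.case_nil (.var rfl) (.pair (.var rfl) .nil)) (by simp)
  | a :: p => .unpack rfl (.case_pair (.var rfl) (.pair (.var rfl)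
      (.call (fn_snoc b p) (.pair (.var rfl) (.var rfl)))))
      (by simp only [List.length_cons]; omega)

/-- Each bit appended to the path is compensated by a node left out of the remaining forest, so `N`
bounds all path lengths and with them the cost of each `snoc`. -/
theorem fn_nodes {N : ℕ} : ∀ (ts : List (LTree Λ)) (w : Pos) (L : List (Pos × Λ)),
    w.length + (nodes ts).length ≤ N →
    Fn 2 (.pair (Val.ofList (ts.map LTree.encode))
        (.pair (encPos w) (Val.ofList (L.map encNode))))
      (Val.ofList (((nodes ts).map (fun x => (w ++ x.1, x.2)) ++ L).map encNode))
      ((nodes ts).length * (20 * (N + 1) + 60) + 10)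
  | [], w, L, _ => .unpack rfl (.case_pair (.var rfl) (.case_nil (.var rfl)
      (.var (by simp [nodes])))) (by simp)
  | .node a cs :: ts, w, L, hN => by
    simp only [nodes, List.length_cons, List.length_append, List.length_map] at hN ⊢
    have h1 := fn_nodes (N := N) ts (w ++ [true]) L (by simp; omega)
    have h2 := fn_nodes (N := N) cs (w ++ [false])
      ((nodes ts).map (fun x => (w ++ [true] ++ x.1, x.2)) ++ L) (by simp; omega)
    rw [show (([false], a) :: ((nodes cs).map (fun x => (false :: x.1, x.2)) ++
          (nodes ts).map (fun x => (true :: x.1, x.2)))).map (fun x => (w ++ x.1, x.2)) ++ L =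
        (w ++ [false], a) :: ((nodes cs).map (fun x => (w ++ [false] ++ x.1, x.2)) ++
          ((nodes ts).map (fun x => (w ++ [true] ++ x.1, x.2)) ++ L)) by
        simp [List.append_assoc, Function.comp_def], List.map_cons, LTree.encode]
    refine .unpack rfl (.case_pair (.var rfl) (.case_pair (.var rfl) (.case_pair (.var rfl)
      (.bind (.call (fn_snoc true w) (.pair (.var rfl) .yes))
      (.bind (.call h1 (.pair (.var rfl) (.pair (.var rfl) (.var rfl))))
      (.bind (.call (fn_snoc false w) (.pair (.var rfl) .nil))
      (.pair (.pair (.var rfl) (.var rfl))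
        (.call h2 (.pair (.var rfl) (.pair (.var rfl) (.var rfl))))))))))) ?_
    nlinarith

/-! ## The solver -/

/-- A domain with at most three positions of length at most `N`. -/
def Small (N : ℕ) (d : List Pos) : Prop := d.length ≤ 3 ∧ ∀ p ∈ d, p.length ≤ N

theorem Small.sublist {N : ℕ} {d e : List Pos} (h : Small N d) (he : e.Sublist d) : Small N e :=
  ⟨he.length_le.trans h.1, fun p hp => h.2 p (he.subset hp)⟩

theorem small_filterApart {N : ℕ} {q : Pos} {ds : List (List Pos)} (h : ∀ d ∈ ds, Small N d) :
    ∀ d ∈ filterApart q ds, Small N d := by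
  intro d hd
  obtain ⟨e, he, rfl⟩ := List.mem_map.1 hd
  exact (h e he).sublist List.filter_sublist

theorem small_propagate {N : ℕ} {ds es : List (List Pos)} (h : ∀ d ∈ ds, Small N d)
    (he : propagate ds = some es) : (∀ d ∈ es, Small N d) ∧ es.length ≤ ds.length := by
  obtain ⟨_, r, h1, h2⟩ := propagate_sublist he
  refine ⟨fun d hd => ?_, h2.length_eq ▸ h1.length_le⟩
  obtain ⟨i, hi, rfl⟩ := List.getElem_of_mem hd
  rw [List.forall₂_iff_get] at h2
  exact (h _ (h1.subset (List.getElem_mem _))).sublist (h2.2 i hi (h2.1 ▸ hi))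

/-- The cost of a pass over at most `D` domains. -/
def passCost (N D : ℕ) : ℕ := (D + 1) * (300 * (N + 1))

theorem fn_filterPass {f i j N D : ℕ} {g : Pos → Pos → Bool} {p : Pos} {ds : List (List Pos)}
    (hi : Prog.prog[i]? = some (Prog.filter f i)) (hj : Prog.prog[j]? = some (Prog.map i j))
    (hf : ∀ p q, Fn (Λ := Λ) f (.pair (encPos p) (encPos q)) (Val.ofBool (g p q))
      (30 * (p.length + 1)))
    (hp : p.length ≤ N) (hds : ∀ d ∈ ds, Small N d) (hD : ds.length ≤ D) :
    Fn (Λ := Λ) j (.pair (encPos p) (encDoms ds)) (encDoms (ds.map (List.filter (g p))))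
      ((D + 1) * (220 * (N + 1))) := by
  refine Fn.le (Fn.map (b := 200 * (N + 1)) hj fun d hd => ?_) ?_
  · refine Fn.le (Fn.filter (p := g p) hi fun q _ => hf p q) ?_
    have h1 := (hds d hd).1
    calc (d.length + 1) * (30 * (p.length + 1) + 20) ≤ (3 + 1) * (30 * (N + 1) + 20) := by gcongr
      _ ≤ _ := by omega
  · gcongr; omega

theorem fn_filterApart {N D : ℕ} {q : Pos} {ds : List (List Pos)} (hq : q.length ≤ N)
    (hds : ∀ d ∈ ds, Small N d) (hD : ds.length ≤ D) :
    Fn (Λ := Λ) 8 (.pair (encPos q) (encDoms ds)) (encDoms (filterApart q ds))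
      ((D + 1) * (220 * (N + 1))) :=
  fn_filterPass (i := 7) rfl rfl fn_apart hq hds hD

theorem fn_filterBelow {N D : ℕ} {q : Pos} {ds : List (List Pos)} (hq : q.length ≤ N)
    (hds : ∀ d ∈ ds, Small N d) (hD : ds.length ≤ D) :
    Fn (Λ := Λ) 6 (.pair (encPos q) (encDoms ds)) (encDoms (filterBelow q ds))
      ((D + 1) * (220 * (N + 1))) :=
  fn_filterPass (i := 5) rfl rfl fn_below hq hds hD

/-- The value of a result of `findShort`. -/
def encShort : Option (List Pos × List (List Pos)) → Val Λ
  | none => .nil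
  | some (d, r) => .pair (encDom d) (encDoms r)

theorem fn_findShort : ∀ ds : List (List Pos),
    Fn (Λ := Λ) 9 (encDoms ds) (encShort (findShort ds)) ((ds.length + 1) * 20)
  | [] => ⟨_, rfl, .le (.case_nil (.var rfl) .nil) (by simp)⟩
  | [] :: r => ⟨_, rfl, .le (.case_pair (.var rfl) (.case_nil (.var rfl)
      (.pair (.var rfl) (.var rfl)))) (by simp only [List.length_cons]; omega)⟩
  | [a] :: r => ⟨_, rfl, .le (.case_pair (.var rfl) (.case_pair (.var rfl) (.case_nil (.var rfl)
      (.pair (.var rfl) (.var rfl))))) (by simp only [List.length_cons]; omega)⟩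
  | (a :: b :: d) :: r => by
    refine ⟨_, rfl, .le (.case_pair (.var rfl) (.case_pair (.var rfl) (.case_pair (.var rfl)
      (.bind (.call (fn_findShort r) (.var rfl)) (t := 10) ?_)))) ?_⟩
    · rw [findShort, if_neg (by simp)]
      rcases findShort r with _ | ⟨e, es⟩
      · exact .le (.case_nil (.var rfl) .nil) (by simp)
      · exact .le (.case_pair (.var rfl) (.pair (.var rfl) (.pair (.var rfl) (.var rfl)))) (by simp)
    · simp only [List.length_cons]; omega

/-- The value of a result of `propagate`. -/
def encResult : Option (List (List Pos)) → Val Λ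
  | none => .nil
  | some ds => .pair .nil (encDoms ds)

/-- Each round removes one domain, at the price of one `findShort` and one filter pass, which
together fit into `passCost`. -/
theorem fn_propagate {N D : ℕ} (ds : List (List Pos)) (hds : ∀ d ∈ ds, Small N d)
    (hD : ds.length ≤ D) :
    Fn (Λ := Λ) 10 (encDoms ds) (encResult (propagate ds)) ((ds.length + 1) * passCost N D) := by
  have hpass : (ds.length + 1) * 20 + (D + 1) * (220 * (N + 1)) + 20 ≤ passCost N D := by
    rw [passCost]; nlinarith [Nat.zero_le (N * D)]
  fun_induction propagate ds with
  | case1 ds h =>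
    refine ⟨_, rfl, .le (.bind (.call (fn_findShort ds) (.var rfl))
      (.case_nil (.var (by rw [h]; rfl)) (.pair .nil (.var rfl)))) ?_⟩
    nlinarith [Nat.zero_le (ds.length * passCost N D)]
  | case2 ds r h =>
    refine ⟨_, rfl, .le (.bind (.call (fn_findShort ds) (.var rfl))
      (.case_pair (.var (by rw [h]; rfl)) (.case_nil (.var rfl) .nil))) ?_⟩
    nlinarith [Nat.zero_le (ds.length * passCost N D)]
  | case3 ds q t r h ih =>
    have hl := findShort_length h
    obtain ⟨_, h2, h3⟩ := findShort_some h
    have hr : ∀ d ∈ r, Small N d := fun d hd => hds d (h3.subset hd)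
    have hq : q.length ≤ N := (hds (q :: t) (h2.mem_iff.2 (by simp))).2 q (by simp)
    have ih := ih (small_filterApart hr) (by simp; omega) (by simp; nlinarith)
    refine ⟨_, rfl, .le (.bind (.call (fn_findShort ds) (.var rfl))
      (.case_pair (.var (by rw [h]; rfl)) (.case_pair (.var rfl) (.call ih
        (.call (fn_filterApart hq hr (D := D) (by omega)) (.pair (.var rfl) (.var rfl))))))) ?_⟩
    rw [length_filterApart]
    rw [hl] at hpass ⊢
    nlinarith

/-- Both committing and dropping an element lower the weight by at least one. Between two such
events lie one filter pass and one propagation, paid by `(D + 2) * passCost N D`. -/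
theorem fn_solve {N D : ℕ} (ds : List (List Pos)) (hds : ∀ d ∈ ds, Small N d)
    (hD : ds.length ≤ D) :
    Fn (Λ := Λ) 11 (encDoms ds) (Val.ofBool (solve ds))
      ((weight ds + 1) * ((D + 2) * passCost N D)) := by
  have hpass : (D + 1) * (220 * (N + 1)) + 20 ≤ passCost N D := by
    rw [passCost]; nlinarith [Nat.zero_le (N * D)]
  have hone : 20 ≤ (D + 2) * passCost N D := by nlinarith
  fun_induction solve ds with
  | case1 => exact ⟨_, rfl, .le (.case_nil (.var rfl) .yes) (by nlinarith)⟩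
  | case2 r =>
    exact ⟨_, rfl, .le (.case_pair (.var rfl) (.case_nil (.var rfl) .nil)) (by nlinarith)⟩
  | case3 a d r es h ih =>
    have hr : ∀ d ∈ r, Small N d := fun d hd => hds d (by simp [hd])
    have ha : a.length ≤ N := (hds (a :: d) (by simp)).2 a (by simp)
    rw [List.length_cons] at hD
    obtain ⟨h1, h2⟩ := small_propagate (small_filterApart hr) h
    rw [length_filterApart] at h2
    have hp := fn_propagate (Λ := Λ) _ (small_filterApart hr (q := a)) (D := D) (by simp; omega)
    rw [length_filterApart, h] at hp
    refine ⟨_, rfl, .le (.case_pair (.var rfl) (.case_pair (.var rfl) (.bind (.call hp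
      (.call (fn_filterApart ha hr (D := D) (by omega)) (.pair (.var rfl) (.var rfl))))
      (.case_pair (.var rfl) (.call (ih h1 (by omega)) (.var rfl)))))) ?_⟩
    have hw : weight es + 1 ≤ weight ((a :: d) :: r) := by
      have := weight_propagate h
      have := weight_filterApart a r
      simp only [weight, List.map_cons, List.sum_cons, List.length_cons] at *
      omega
    have h3 : (r.length + 1) * passCost N D ≤ (D + 1) * passCost N D := by gcongr; omega
    have h4 := Nat.mul_le_mul_right ((D + 2) * passCost N D) hw
    linarith
  | case4 a d r h ih =>
    have hr : ∀ d ∈ r, Small N d := fun d hd => hds d (by simp [hd])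
    have ha : a.length ≤ N := (hds (a :: d) (by simp)).2 a (by simp)
    have hdr : ∀ e ∈ d :: r, Small N e := List.forall_mem_cons.2
      ⟨(hds (a :: d) (by simp)).sublist (List.sublist_cons_self _ _), hr⟩
    rw [List.length_cons] at hD
    have hp := fn_propagate (Λ := Λ) _ (small_filterApart hr (q := a)) (D := D) (by simp; omega)
    rw [length_filterApart, h] at hp
    refine ⟨_, rfl, .le (.case_pair (.var rfl) (.case_pair (.var rfl) (.bind (.call hp
      (.call (fn_filterApart ha hr (D := D) (by omega)) (.pair (.var rfl) (.var rfl))))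
      (.case_nil (.var rfl) (.call (ih hdr (by simpa using hD))
        (.pair (.var rfl) (.var rfl))))))) ?_⟩
    have hw : weight (d :: r) + 1 = weight ((a :: d) :: r) := by
      simp only [weight, List.map_cons, List.sum_cons, List.length_cons]
      omega
    have h3 : (r.length + 1) * passCost N D ≤ (D + 1) * passCost N D := by gcongr; omega
    rw [← hw]
    linarith

/-- The cost of a call of `solve` with at most `D` domains. -/
def solveCost (N D : ℕ) : ℕ := (4 * D + 1) * ((D + 2) * passCost N D)

theorem fn_solve' {N D : ℕ} {ds : List (List Pos)} (hds : ∀ d ∈ ds, Small N d)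
    (hD : ds.length ≤ D) :
    Fn (Λ := Λ) 11 (encDoms ds) (Val.ofBool (solve ds)) (solveCost N D) := by
  refine (fn_solve ds hds hD).le ?_
  -- A domain of at most three positions contributes at most `3 + 1`.
  have : weight ds ≤ 4 * ds.length := by
    rw [weight, mul_comm, ← smul_eq_mul, ← List.length_map (f := fun d => d.length + 1)]
    refine List.sum_le_card_nsmul _ _ fun x hx => ?_
    obtain ⟨d, hd, rfl⟩ := List.mem_map.1 hx
    exact Nat.succ_le_succ (hds d hd).1
  rw [solveCost]
  gcongr
  omega

theorem fn_erase0 : ∀ d : List Pos,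
    Fn (Λ := Λ) 12 (encDom d) (encDom (d.eraseIdx 0)) 3
  | [] => ⟨_, rfl, .case_nil (.var rfl) .nil⟩
  | _ :: _ => ⟨_, rfl, .case_pair (.var rfl) (.var rfl)⟩

theorem fn_erase1 : ∀ d : List Pos,
    Fn (Λ := Λ) 13 (encDom d) (encDom (d.eraseIdx 1)) 9
  | [] => ⟨_, rfl, .le (.case_nil (.var rfl) .nil) (by simp)⟩
  | _ :: d => ⟨_, rfl, .case_pair (.var rfl) (.pair (.var rfl) (.call (fn_erase0 d) (.var rfl)))⟩

theorem fn_erase2 : ∀ d : List Pos,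
    Fn (Λ := Λ) 14 (encDom d) (encDom (d.eraseIdx 2)) 15
  | [] => ⟨_, rfl, .le (.case_nil (.var rfl) .nil) (by simp)⟩
  | _ :: d => ⟨_, rfl, .case_pair (.var rfl) (.pair (.var rfl) (.call (fn_erase1 d) (.var rfl)))⟩

/-- The number of calls of `solve` for `n` domains. -/
def leaves : ℕ → ℕ
  | 0 => 1
  | 1 => 3
  | n + 2 => 3 * leaves n

/-- The slack `150` closes the induction: three recursive calls release it three times, which pays
for the work at this branching and leaves `150` over. -/
theorem fn_branch {N D : ℕ} : ∀ (ds es : List (List Pos)), (∀ d ∈ ds, Small N d) →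
    (∀ e ∈ es, Small N e) → ds.length + es.length ≤ D →
    ∃ b, Fn (Λ := Λ) 15 (.pair (encDoms ds) (encDoms es)) (Val.ofBool (branch ds es)) b ∧
      b + 150 ≤ leaves ds.length * (solveCost N D + 200)
  | [], es, _, he, hD => by
    rw [List.length_nil, zero_add] at hD
    refine ⟨_, .unpack rfl (.case_nil (.var rfl) (.call (fn_solve' he hD) (.var rfl))) le_rfl, ?_⟩
    simp [leaves]; omega
  | [x], es, hd, he, hD => by
    have hx := hd x (by simp)
    have key : ∀ {f k}, Fn (Λ := Λ) f (encDom x) (encDom (x.eraseIdx k)) 15 →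
        Ev (Λ := Λ) [encDom x, .nil, encDoms [x], encDoms es, .pair (encDoms [x]) (encDoms es)]
          (Prog.branchLast f) (Val.ofBool (solve (x.eraseIdx k :: es))) (solveCost N D + 22) :=
      fun {f k} hf => .le (.call (fn_solve' (N := N) (D := D) (List.forall_mem_cons.2
          ⟨hx.sublist (List.eraseIdx_sublist ..), he⟩) (by simp at hD ⊢; omega))
        (.pair (.call hf (.var rfl)) (.var rfl))) (by omega)
    refine ⟨_, .unpack rfl (.case_pair (.var rfl) (.case_nil (.var rfl)
      (.or (key ((fn_erase0 x).le (by simp))) (.or (key ((fn_erase1 x).le (by simp)))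
        (key (fn_erase2 x)))))) le_rfl, ?_⟩
    simp only [List.length_cons, List.length_nil, leaves]; omega
  | x :: y :: r, es, hd, he, hD => by
    have hx := hd x (by simp)
    have hy := hd y (by simp)
    have key : ∀ {f k}, Fn (Λ := Λ) f (encDom x) (encDom (x.eraseIdx k)) 15 →
        Fn (Λ := Λ) f (encDom y) (encDom (y.eraseIdx k)) 15 → ∃ b,
        Ev (Λ := Λ) [encDom y, encDoms r, encDom x, encDoms (y :: r), encDoms (x :: y :: r),
            encDoms es, .pair (encDoms (x :: y :: r)) (encDoms es)] (Prog.branchPair f)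
          (Val.ofBool (branch r (x.eraseIdx k :: y.eraseIdx k :: es))) b ∧
        b + 100 ≤ leaves r.length * (solveCost N D + 200) := by
      intro f k hfx hfy
      obtain ⟨b, hb, hb'⟩ := fn_branch (N := N) (D := D) r (x.eraseIdx k :: y.eraseIdx k :: es)
        (fun d h => hd d (by simp [h])) (List.forall_mem_cons.2
          ⟨hx.sublist (List.eraseIdx_sublist ..), List.forall_mem_cons.2
            ⟨hy.sublist (List.eraseIdx_sublist ..), he⟩⟩) (by simp at hD ⊢; omega)
      refine ⟨_, .call hb (.pair (.var rfl) (.pair (.call hfx (.var rfl))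
        (.pair (.call hfy (.var rfl)) (.var rfl)))), ?_⟩
      omega
    obtain ⟨b₀, h0, h0'⟩ := key ((fn_erase0 x).le (by simp)) ((fn_erase0 y).le (by simp))
    obtain ⟨b₁, h1, h1'⟩ := key ((fn_erase1 x).le (by simp)) ((fn_erase1 y).le (by simp))
    obtain ⟨b₂, h2, h2'⟩ := key (fn_erase2 x) (fn_erase2 y)
    refine ⟨_, .unpack rfl (.case_pair (.var rfl) (.case_pair (.var rfl)
      (.or h0 (.or h1 h2)))) le_rfl, ?_⟩
    simp only [List.length_cons, leaves, mul_assoc]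
    omega

/-! ## Candidates -/

theorem leaves_mono : Monotone leaves := by
  refine monotone_nat_of_le_succ fun n => ?_
  induction n using leaves.induct with
  | case1 => simp [leaves]
  | case2 => simp [leaves]
  | case3 n ih => simp only [leaves] at *; omega

theorem one_le_leaves (n : ℕ) : 1 ≤ leaves n := leaves_mono (Nat.zero_le n)

/-- Two domains cost a factor `3 ≤ 1.8 ^ 2 = 3.24`. The factor `2` absorbs an unpaired domain, as `3
≤ 2 * 1.8`. -/
theorem leaves_le (n : ℕ) : (leaves n : ℝ) ≤ 2 * (1.8 : ℝ) ^ n := by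
  induction n using leaves.induct with
  | case1 => norm_num [leaves]
  | case2 => norm_num [leaves]
  | case3 n ih =>
    rw [leaves, pow_succ, pow_succ]
    push_cast
    have : (0 : ℝ) < 1.8 ^ n := by positivity
    nlinarith

/-- The value of a list of labeled positions. -/
def encNodes (L : List (Pos × Λ)) : Val Λ := Val.ofList (L.map encNode)

theorem small_filterBelow {N : ℕ} {q : Pos} {ds : List (List Pos)} (h : ∀ d ∈ ds, Small N d) :
    ∀ d ∈ filterBelow q ds, Small N d := by
  intro d hd
  obtain ⟨e, he, rfl⟩ := List.mem_map.1 hd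
  exact (h e he).sublist List.filter_sublist

/-- The cost of the search for the positions of a node with at most `D` children. -/
def nodeCost (N D : ℕ) : ℕ := passCost N D + leaves D * (solveCost N D + 200)

theorem fn_scan [DecidableEq Λ] {N D : ℕ} {a : Λ} {ds : List (List Pos)}
    (hds : ∀ d ∈ ds, Small N d) (hD : ds.length ≤ D) : ∀ L : List (Pos × Λ),
    (∀ x ∈ L, x.1.length ≤ N) →
    Fn 16 (.pair (encNodes L) (.pair (.atom a) (encDoms ds))) (encDom (scan a ds L))
      ((L.length + 1) * nodeCost N D)
  | [], _ => .unpack rfl (.case_pair (.var rfl) (.case_nil (.var rfl) .nil)) (by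
      have := Nat.mul_le_mul_right (solveCost N D + 200) (one_le_leaves D)
      simp only [List.length_nil, nodeCost]; omega)
  | (p, b) :: L, hL => by
    have ih := fn_scan (a := a) hds hD L fun x hx => hL x (by simp [hx])
    have hp : p.length ≤ N := hL (p, b) (by simp)
    have hpass : (D + 1) * (220 * (N + 1)) + 50 ≤ passCost N D := by
      rw [passCost]; nlinarith [Nat.zero_le (N * D)]
    obtain ⟨c, h1, h2⟩ := fn_branch (Λ := Λ) (N := N) (D := D) (filterBelow p ds) []
      (small_filterBelow hds) (by simp) (by simpa [filterBelow] using hD)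
    have h3 : leaves (filterBelow p ds).length * (solveCost N D + 200) ≤
        leaves D * (solveCost N D + 200) :=
      Nat.mul_le_mul_right _ (leaves_mono (by simpa [filterBelow] using hD))
    refine .unpack (s := (L.length + 1) * nodeCost N D + ((D + 1) * (220 * (N + 1)) + c + 50)) rfl
      (.le (.case_pair (.var rfl) (.case_pair (.var rfl)
      (.bind (.call ih (.pair (.var rfl) (.var rfl))) (.case_pair (.var rfl)
        (t := (D + 1) * (220 * (N + 1)) + c + 25) ?_)))) (by omega)) ?_
    · rw [scan]
      split_ifs with hb hs
      · subst hb
        rw [hs] at h1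
        exact .le (.ifEq_true (.var rfl) (.var rfl) (.case_pair (.call h1 (.pair
          (.call (fn_filterBelow hp hds hD) (.pair (.var rfl) (.var rfl))) .nil))
          (.pair (.var rfl) (.var rfl)))) (by omega)
      · subst hb
        rw [Bool.eq_false_iff.2 hs] at h1
        exact .le (.ifEq_true (.var rfl) (.var rfl) (.case_nil (.call h1 (.pair
          (.call (fn_filterBelow hp hds hD) (.pair (.var rfl) (.var rfl))) .nil))
          (.var rfl))) (by omega)
      · exact .le (.ifEq_false (.var rfl) (.var rfl) hb (.var rfl)) (by omega)
    · have : (D + 1) * (220 * (N + 1)) + c + 52 ≤ nodeCost N D := by rw [nodeCost]; omega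
      rw [List.length_cons, add_mul (L.length + 1) 1]
      omega

theorem fn_noneBelow {N : ℕ} {p : Pos} (hp : p.length ≤ N) : ∀ qs : List Pos,
    Fn (Λ := Λ) 17 (.pair (encDom qs) (encPos p)) (Val.ofBool (!qs.any (below p)))
      ((qs.length + 1) * (50 * (N + 1)))
  | [] => .unpack rfl (.case_nil (.var rfl) .yes) (by simp; omega)
  | q :: qs => by
    refine .unpack (s := 30 * (p.length + 1) + (qs.length + 1) * (50 * (N + 1)) + 16) rfl
      (.le (.case_pair (.var rfl) (.case_bool (t := (qs.length + 1) * (50 * (N + 1)) + 5)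
        (.call (fn_below p q) (.pair (.var rfl) (.var rfl))) ?_ ?_)) (by omega)) ?_
    · intro h
      rw [List.any_cons, h, Bool.false_or]
      exact .le (.call (fn_noneBelow hp qs) (.pair (.var rfl) (.var rfl))) (by omega)
    · intro h
      rw [List.any_cons, h, Bool.true_or]
      exact .le .nil (by omega)
    · rw [List.length_cons, add_mul (qs.length + 1) 1]
      omega

theorem fn_lowest {N : ℕ} {ps : List Pos} (hps : ∀ p ∈ ps, p.length ≤ N) (hl : ps.length ≤ N) :
    Fn (Λ := Λ) 18 (.pair (encDom ps) (encDom ps)) (encDom (lowest ps ps))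
      ((N + 1) * ((N + 1) * (70 * (N + 1)))) := by
  refine Fn.le (Fn.filter rfl fun p hp => (fn_noneBelow (hps p hp) ps).le (b :=
    (N + 1) * (50 * (N + 1))) (by gcongr)) ?_
  gcongr
  nlinarith

/-! ### Size and outdegree of the pattern -/

theorem size_node (a : Λ) (cs : List (LTree Λ)) :
    (LTree.node a cs).size = (cs.map LTree.size).sum + 1 := by
  simp only [LTree.size, LTree.labels, List.length_cons, List.length_flatten, List.map_map]
  rfl

theorem length_le_maxOutdegree (a : Λ) (cs : List (LTree Λ)) :
    cs.length ≤ (LTree.node a cs).maxOutdegree := by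
  rw [LTree.maxOutdegree]; exact le_max_left _ _

theorem maxOutdegree_child {a : Λ} {c : LTree Λ} {cs : List (LTree Λ)} (hc : c ∈ cs) :
    c.maxOutdegree ≤ (LTree.node a cs).maxOutdegree := by
  rw [LTree.maxOutdegree]
  refine le_trans ?_ (le_max_right _ _)
  induction cs with
  | nil => simp at hc
  | cons d cs ih =>
    rw [List.map_cons, List.foldr_cons]
    rcases List.mem_cons.1 hc with rfl | hc
    · exact le_max_left _ _
    · exact (ih hc).trans (le_max_right _ _)

theorem maxOutdegree_le_size (u : LTree Λ) : u.maxOutdegree ≤ u.size := by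
  induction u using LTree.induction with
  | node a cs ih =>
    rw [LTree.maxOutdegree, size_node]
    have h : ∀ ds : List (LTree Λ), (∀ d ∈ ds, d.maxOutdegree ≤ d.size) →
        ds.length ≤ (ds.map LTree.size).sum ∧
        (ds.map LTree.maxOutdegree).foldr max 0 ≤ (ds.map LTree.size).sum := by
      intro ds h
      induction ds with
      | nil => simp
      | cons d ds ih =>
        obtain ⟨h1, h2⟩ := ih fun e he => h e (by simp [he])
        have h3 := h d (by simp)
        have h4 : 1 ≤ d.size := by cases d; rw [size_node]; omega
        simp only [List.map_cons, List.foldr_cons, List.sum_cons, List.length_cons]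
        omega
    have := h cs ih
    omega

/-- The cost for each node of the pattern. -/
def candsCost (N D : ℕ) : ℕ :=
  (N + 1) * nodeCost N D + (N + 1) * ((N + 1) * (70 * (N + 1))) + 60

theorem small_cands [DecidableEq Λ] {N : ℕ} {L : List (Pos × Λ)} {u : LTree Λ} (h : Bounded L u)
    (hL : ∀ x ∈ L, x.1.length ≤ N) : Small N (cands L u) := by
  obtain ⟨h1, _, h2⟩ := cands_spec u h
  refine ⟨h2, fun p hp => ?_⟩
  obtain ⟨a, ha⟩ := emb_mem (h1 p hp)
  exact hL _ ha

theorem length_scan_le [DecidableEq Λ] (a : Λ) (ds : List (List Pos)) :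
    ∀ L : List (Pos × Λ), (scan a ds L).length ≤ L.length
  | [] => by simp [scan]
  | (p, b) :: L => by
    have := length_scan_le a ds L
    rw [scan]
    split_ifs <;> simp only [List.length_cons] <;> omega

/-- The slack `20` of each subtree pays for its entry in the pass over the child list, so the costs
add up to the number of pattern nodes times `candsCost`. -/
theorem fn_cands [DecidableEq Λ] {N D : ℕ} {L : List (Pos × Λ)} (hN : L.length ≤ N)
    (hL : ∀ x ∈ L, x.1.length ≤ N) (u : LTree Λ) (h : Bounded L u) (hD : u.maxOutdegree ≤ D) :
    ∃ b, Fn 19 (.pair u.encode (encNodes L)) (encDom (cands L u)) b ∧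
      b + 20 ≤ u.size * candsCost N D := by
  induction u using LTree.induction with
  | node a cs ih =>
    have hlist : ∀ ds : List (LTree Λ), (∀ d ∈ ds, d ∈ cs) →
        ∃ b, Fn 20 (.pair (Val.ofList (ds.map LTree.encode)) (encNodes L))
          (encDoms (ds.map (cands L))) b ∧ b ≤ (ds.map LTree.size).sum * candsCost N D + 10 := by
      intro ds hds
      induction ds with
      | nil => exact ⟨_, .unpack rfl (.case_nil (.var rfl) .nil) le_rfl, by simp⟩
      | cons d ds ih' =>
        have hd := hds d (by simp)
        obtain ⟨b, h1, h2⟩ := ih d hd (h.child hd) ((maxOutdegree_child hd).trans hD)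
        obtain ⟨b', h3, h4⟩ := ih' fun e he => hds e (by simp [he])
        refine ⟨_, .unpack rfl (.case_pair (.var rfl) (.pair
          (.call h1 (.pair (.var rfl) (.var rfl)))
          (.call h3 (.pair (.var rfl) (.var rfl))))) le_rfl, ?_⟩
        rw [List.map_cons, List.sum_cons, add_mul]
        omega
    obtain ⟨b, h1, h2⟩ := hlist cs fun _ => id
    have hds : ∀ d ∈ cs.map (cands L), Small N d := by
      intro d hd
      obtain ⟨c, hc, rfl⟩ := List.mem_map.1 hd
      exact small_cands (h.child hc) hL
    have h3 := fn_scan (a := a) (D := D) hds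
      (by rw [List.length_map]; exact (length_le_maxOutdegree a cs).trans hD) L hL
    have h4 := fn_lowest (Λ := Λ) (N := N) (ps := scan a (cs.map (cands L)) L)
      (fun p hp => hL _ (mem_scan.1 hp).1) ((length_scan_le _ _ _).trans hN)
    rw [LTree.encode, cands]
    refine ⟨_, .unpack rfl (.case_pair (.var rfl) (.bind
      (.call h1 (.pair (.var rfl) (.var rfl)))
      (.bind (.call h3 (.pair (.var rfl) (.pair (.var rfl) (.var rfl))))
      (.call h4 (.pair (.var rfl) (.var rfl)))))) le_rfl, ?_⟩
    have h5 : (L.length + 1) * nodeCost N D ≤ (N + 1) * nodeCost N D := by gcongr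
    rw [size_node, add_mul (List.sum _) 1, one_mul]
    simp only [candsCost] at *
    omega

theorem fn_main [DecidableEq Λ] {P T : LTree Λ} (h : ∀ a ∈ P.leafLabels, T.labels.count a ≤ 3) :
    ∃ b, Fn 0 (.pair P.encode T.encode) (Val.ofBool !(cands (nodes [T]) P).isEmpty) b ∧
      b ≤ P.size * candsCost (P.size + T.size) P.maxOutdegree +
        T.size * (20 * (P.size + T.size + 1) + 60) + 50 := by
  have hN : (nodes [T]).length ≤ P.size + T.size := by rw [length_nodes]; omega
  have h1 := fn_nodes (N := P.size + T.size) [T] [] [] (by simpa using hN)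
  rw [length_nodes] at h1
  simp only [List.nil_append, Prod.mk.eta, List.map_id', List.append_nil] at h1
  obtain ⟨b, h2, h3⟩ := fn_cands hN (fun x hx => (length_le_of_mem_nodes hx).trans hN) P
    (bounded_nodes h) le_rfl
  refine ⟨_, .unpack rfl (.bind (.call h1 (.pair (.pair (.var rfl) .nil) (.pair .nil .nil)))
    (.bind (.call h2 (.pair (.var rfl) (.var rfl))) (t := 5) ?_)) le_rfl, ?_⟩
  · cases cands (nodes [T]) P with
    | nil => exact .le (.case_nil (.var rfl) .nil) (by simp)
    | cons p ps => exact .case_pair (.var rfl) .yes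
  · omega

/-! ### Arithmetic of the total bound -/

theorem candsCost_le {N D : ℕ} (hD : D ≤ N) :
    candsCost N D ≤ leaves D * (5000 * (N + 1) ^ 5) := by
  have hG := one_le_leaves D
  have h1 : passCost N D ≤ 300 * (N + 1) ^ 2 := by
    rw [passCost]
    calc (D + 1) * (300 * (N + 1)) ≤ (N + 1) * (300 * (N + 1)) := by gcongr
      _ = _ := by ring
  have h2 : solveCost N D ≤ 2400 * (N + 1) ^ 4 := by
    rw [solveCost]
    calc (4 * D + 1) * ((D + 2) * passCost N D)
        ≤ (4 * (N + 1)) * ((2 * (N + 1)) * (300 * (N + 1) ^ 2)) := by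
          gcongr <;> omega
      _ = _ := by ring
  have hp : ∀ i ≤ 4, (N + 1) ^ i ≤ (N + 1) ^ 4 := fun i hi =>
    Nat.pow_le_pow_right (by omega) hi
  have h3 : nodeCost N D ≤ leaves D * (2900 * (N + 1) ^ 4) := by
    have := hp 2 (by norm_num)
    have : 1 ≤ (N + 1) ^ 4 := Nat.one_le_pow _ _ (by omega)
    calc nodeCost N D ≤ leaves D * passCost N D + leaves D * (solveCost N D + 200) := by
          rw [nodeCost]; gcongr; exact Nat.le_mul_of_pos_left _ hG
      _ = leaves D * (passCost N D + solveCost N D + 200) := by ring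
      _ ≤ _ := by gcongr; omega
  have h4 : 70 * (N + 1) ^ 3 + 60 ≤ 130 * (N + 1) ^ 5 := by
    have h5 : (N + 1) ^ 3 ≤ (N + 1) ^ 5 := Nat.pow_le_pow_right (by omega) (by norm_num)
    have h6 : 1 ≤ (N + 1) ^ 5 := Nat.one_le_pow _ _ (by omega)
    omega
  calc candsCost N D = (N + 1) * nodeCost N D + (70 * (N + 1) ^ 3 + 60) := by
        rw [candsCost]; ring
    _ ≤ (N + 1) * (leaves D * (2900 * (N + 1) ^ 4)) + leaves D * (130 * (N + 1) ^ 5) := by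
        gcongr
        exact h4.trans (Nat.le_mul_of_pos_left _ hG)
    _ = leaves D * (3030 * (N + 1) ^ 5) := by ring
    _ ≤ _ := by gcongr; norm_num

theorem totalCost_le {m n D : ℕ} (hm : 1 ≤ m) (hD : D ≤ m) :
    m * candsCost (m + n) D + n * (20 * (m + n + 1) + 60) + 54 ≤
      leaves D * (200000 * (m + n) ^ 6) := by
  have hG := one_le_leaves D
  set N := m + n with hN
  have h1 : candsCost N D ≤ leaves D * (160000 * N ^ 5) := by
    refine (candsCost_le (by omega)).trans ?_
    -- Here `N + 1 ≤ 2 * N`, and `5000 * 2 ^ 5 = 160000`.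
    calc leaves D * (5000 * (N + 1) ^ 5) ≤ leaves D * (5000 * (2 * N) ^ 5) := by gcongr; omega
      _ = _ := by ring
  have h2 : N ^ 2 ≤ N ^ 6 := Nat.pow_le_pow_right (by omega) (by norm_num)
  have h3 : n * (20 * (N + 1) + 60) + 54 ≤ 154 * N ^ 6 := by
    refine le_trans ?_ (Nat.mul_le_mul_left 154 h2)
    nlinarith
  calc m * candsCost N D + n * (20 * (N + 1) + 60) + 54
      ≤ N * (leaves D * (160000 * N ^ 5)) + leaves D * (154 * N ^ 6) := by
        rw [add_assoc]
        gcongr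
        · omega
        · exact h3.trans (Nat.le_mul_of_pos_left _ hG)
    _ = leaves D * (160154 * N ^ 6) := by ring
    _ ≤ _ := by gcongr; norm_num

end TreeInclusion

theorem theorem4 :
    ∃ (prog : TreeInclusion.Program) (C k : ℕ),
      ∀ (Λ : Type) [DecidableEq Λ] (P T : TreeInclusion.LTree Λ),
        P.leafLabels.Nodup →
        (∀ a ∈ P.leafLabels, T.labels.count a ≤ 3) →
        ∃ (answer : Bool) (t : ℕ),
          prog.Runs (.pair P.encode T.encode) (TreeInclusion.Val.ofBool answer) t ∧
          (answer = true ↔ P.Included T) ∧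
          (t : ℝ) ≤ C * (1.8 : ℝ) ^ P.maxOutdegree * ((P.size : ℝ) + T.size) ^ k := by
  open TreeInclusion in
  -- The exponent and a factor `200000` come from `totalCost_le`, the other factor `2` from
  -- `leaves_le`.
  refine ⟨Prog.prog, 400000, 6, fun Λ _ P T _ h => ?_⟩
  obtain ⟨b, h1, h2⟩ := fn_main h
  obtain ⟨t, ht, hrun⟩ := Ev.call (env := [.pair P.encode T.encode]) h1 (.var (i := 0) rfl)
  refine ⟨_, t, hrun, ?_, ?_⟩
  · rw [included_iff_cands h]
    simp
  · have hm : 1 ≤ P.size := by cases P; rw [size_node]; omega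
    have h3 : t ≤ leaves P.maxOutdegree * (200000 * (P.size + T.size) ^ 6) :=
      -- The `54` there covers the `50` of `fn_main` and the two steps of the outer call.
      le_trans (by omega) (totalCost_le hm (maxOutdegree_le_size P))
    calc (t : ℝ) ≤ leaves P.maxOutdegree * (200000 * ((P.size : ℝ) + T.size) ^ 6) := by
          exact_mod_cast h3
      _ ≤ 2 * (1.8 : ℝ) ^ P.maxOutdegree * (200000 * ((P.size : ℝ) + T.size) ^ 6) := by
          gcongr; exact leaves_le _
      _ = _ := by push_cast; ring
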